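/- **Theorem 4.3.** Let $K$ be an algebraically closed field of characteristic zero, let $B\subset\mathrm{GL}(n,K)$ be the group of invertible upper triangular matrices, and let $\mathfrak p=\mathfrak r\oplus\mathfrak m\subset\mathfrak{gl}(n,K)$ be the parabolic subalgebra containing the upper triangular matrices whose block diagonal part $\mathfrak r$ has blocks of sizes $(r_1,\dots,r_u)$, $r_i\ge1$, $\sum r_i=n$, and whose nilradical is $\mathfrak m$ (the block strictly upper triangular matrices). Put $R_k=r_1+\dots+r_k$. Identify the positive root $\varepsilon_i-\varepsilon_j$ with the pair $(i,j)$, $i<j$. Let $M$ be the set of positive roots $(i,j)$ with $i,j$ in different blocks and $\Delta^+_{\mathfrak r}$ the set of those with $i,j$ in the same block, so that $K[\mathfrak m]=K[x_\gamma:\gamma\in M]$, with field of fractions $K(\mathfrak m)$. The group $B$ acts on $K[\mathfrak m]$ and $K(\mathfrak m)$ by $(g\cdot f)(x)=f(g^{-1}xg)$. For roots, write $\gamma'>\gamma$ if $\gamma'-\gamma$ is a positive root. Define the sets $S,\Phi,\Psi$ as follows. * *Base* $S\subset M$: starting from $M$, repeatedly collect all elements $\gamma$ of the current set for which there is no $\xi<\gamma$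 in that set, and remove from it these elements and all $\gamma$ with $\gamma>\xi$ for one of them $\xi$. Then $S$ is the set of all collected elements. * $\Phi$ is the set of roots $(j,l)$ for which there are $(i,j)\in S$ and $(k,l)\in S$ with $(j,k)\in\Delta^+_{\mathfrak r}$. * $\Psi_1$ is the set of $(i,b)\in\Phi$ for which there are $j>i$ and $a<b$ with $(i,a),(j,a),(j,b)\in S\cup\Phi$. * $\Psi_2$ is the set of roots in $\Phi$ of the form $(R_{t-1}+k,\,R_t+1)$ with $1\le k<r_t$ for which there are $s<t$ and $j_1<\dots<j_k$ with $(R_{s-1}+1,j_1),\dots,(R_{s-1}+1,j_k)\in\Phi$. * $\Psi=\Psi_1\cup\Psi_2$. Let $K(\mathcal X)$ be the field of rational functions over $K$ in variables $c_\psi$, $\psi\in\Psi$, where $\mathcal X$ is the set of matrices $\sum_{\psi\in\Psi}c_\psi E_\psi+\sum_{\xi\in(S\cup\Phi)\setminus\Psi}E_\xi$. Let $p\mapsto p|_{\mathcal X}$ be the restriction homomorphism $K[\mathfrak m]\to K[c_\psi:\psi\in\Psi]$, which sends $x_\xi$ to $c_\xi$ if $\xi\in\Psi$, to $1$ if $\xi\in(S\cup\Phi)\setminus\Psi$,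 and to $0$ if $\xi\notin S\cup\Phi$. Then every $f\in K(\mathfrak m)^B$ can be written as $f=p/q$ with $p,q\in K[\mathfrak m]$ and $q|_{\mathcal X}\ne0$, and the restriction map $$\pi:K(\mathfrak m)^B\to K(\mathcal X),\qquad \pi(p/q)=p|_{\mathcal X}/q|_{\mathcal X},$$ is a bijection. -/

import Mathlib

/-!
Throughout, `c : Composition n` lists the sizes `(r₁, …, r_u)` of the diagonal blocks of a standard
parabolic subalgebra of `gl n`. The positive root `ε_i - ε_j`, `i < j`, is identified with the pair
`(i, j) : Fin n × Fin n`; indices of rows, columns and blocks are counted from `0`, so the `t`-th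
block consists of the indices `c.sizeUpTo t, …, c.sizeUpTo (t + 1) - 1`.
-/

namespace BorelNilradical

section Roots

variable {n : ℕ}

/-- The set of positive roots of `gl n`. -/
def posRoots (n : ℕ) : Set (Fin n × Fin n) := {γ | γ.1 < γ.2}

/-- The vector `ε_i - ε_j` of the pair `(i, j)`. -/
def rootVec (γ : Fin n × Fin n) : Fin n → ℤ := Pi.single γ.1 1 - Pi.single γ.2 1

/-- The (non-transitive) relation `γ' > γ` on roots: `γ' - γ` is a positive root. -/
def RootGT (γ' γ : Fin n × Fin n) : Prop :=
  ∃ δ ∈ posRoots n, rootVec γ' - rootVec γ = rootVec δ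

/-- The positive roots whose root spaces span the nilradical `𝔪`. -/
def nilRoots (c : Composition n) : Set (Fin n × Fin n) := {γ | c.index γ.1 < c.index γ.2}

/-- The positive roots of the block diagonal subalgebra `𝔯`. -/
def leviRoots (c : Composition n) : Set (Fin n × Fin n) :=
  {γ | γ.1 < γ.2 ∧ c.index γ.1 = c.index γ.2}

/-- The elements of `A` that are minimal for `RootGT`. -/
def minimalRoots (A : Set (Fin n × Fin n)) : Set (Fin n × Fin n) :=
  {γ | γ ∈ A ∧ ¬ ∃ ξ ∈ A, RootGT γ ξ}

/-- What is left of the roots of `𝔪` after `k` rounds of removing the minimal elements and all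
the roots that are greater than one of them. -/
def remainingRoots (c : Composition n) : ℕ → Set (Fin n × Fin n)
  | 0 => nilRoots c
  | k + 1 => remainingRoots c k \ (minimalRoots (remainingRoots c k) ∪
      {γ | γ ∈ remainingRoots c k ∧ ∃ ξ ∈ minimalRoots (remainingRoots c k), RootGT γ ξ})

/-- The base `S`: the union over all rounds of the minimal elements. -/
def base (c : Composition n) : Set (Fin n × Fin n) :=
  ⋃ k, minimalRoots (remainingRoots c k)

/-- The set `Φ` of the roots `α + ξ'`, where `ξ = (i, j)` and `ξ' = (k, l)` in the base form an
admissible pair, i.e. `α = (j, k)` is a positive root of `𝔯`. -/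
def phi (c : Composition n) : Set (Fin n × Fin n) :=
  {φ | ∃ i j k l, (i, j) ∈ base c ∧ (k, l) ∈ base c ∧ (j, k) ∈ leviRoots c ∧ φ = (j, l)}

/-- The extended base `S ∪ Φ`. -/
def extBase (c : Composition n) : Set (Fin n × Fin n) := base c ∪ phi c

/-- The first series `Ψ₁`: the roots `(i, b)` of `Φ` for which there are `j > i` and `a < b`
with `(i, a)`, `(j, a)`, `(j, b)` in the extended base. -/
def psiOne (c : Composition n) : Set (Fin n × Fin n) :=
  {ψ | ψ ∈ phi c ∧ ∃ j a, ψ.1 < j ∧ a < ψ.2 ∧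
    (ψ.1, a) ∈ extBase c ∧ (j, a) ∈ extBase c ∧ (j, ψ.2) ∈ extBase c}

/-- The second series `Ψ₂`: the roots of `Φ` in the `k`-th row (`1 ≤ k < r_t`) of the `t`-th block
row and in the first column of the next block column, such that for some `s < t` there are `k`
roots of `Φ` in the first row of the `s`-th block row. -/
def psiTwo (c : Composition n) : Set (Fin n × Fin n) :=
  {ψ | ψ ∈ phi c ∧ ∃ (t : Fin c.length) (k : ℕ), 1 ≤ k ∧ k < c.blocksFun t ∧
    (ψ.1 : ℕ) + 1 = c.sizeUpTo t + k ∧ (ψ.2 : ℕ) = c.sizeUpTo ((t : ℕ) + 1) ∧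
    ∃ s : Fin c.length, s < t ∧ ∃ i : Fin n, (i : ℕ) = c.sizeUpTo s ∧
      ∃ j : Fin k → Fin n, StrictMono j ∧ ∀ m, (i, j m) ∈ phi c}

/-- The set `Ψ = Ψ₁ ∪ Ψ₂`. -/
def psi (c : Composition n) : Set (Fin n × Fin n) := psiOne c ∪ psiTwo c

end Roots

section Invariants

variable (K : Type*) [Field K] {n : ℕ}

/-- The Borel subgroup `B` of `GL n K`: the invertible upper triangular matrices. -/
def borel (n : ℕ) : Subgroup (GL (Fin n) K) where
  carrier := {g | (g : Matrix (Fin n) (Fin n) K).BlockTriangular id}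
  mul_mem' {a b} ha hb := by
    simpa using Matrix.BlockTriangular.mul ha hb
  one_mem' := by
    simpa using Matrix.blockTriangular_one
  inv_mem' {a} ha := by
    have := (a : GL (Fin n) K).invertible
    have h := Matrix.blockTriangular_inv_of_blockTriangular (M := (a : Matrix (Fin n) (Fin n) K)) ha
    simpa [Matrix.coe_units_inv] using h

/-- The algebra `K[𝔪]` of polynomial functions on the nilradical. -/
abbrev NilPoly (c : Composition n) : Type _ := MvPolynomial (nilRoots c) K

/-- The field `K(𝔪)` of rational functions on the nilradical. -/
abbrev NilField (c : Composition n) : Type _ := FractionRing (NilPoly K c)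

open Classical in
/-- The generic matrix of `𝔪`: the variables at the roots of `𝔪`, zeros elsewhere. -/
noncomputable def genericMatrix (c : Composition n) : Matrix (Fin n) (Fin n) (NilPoly K c) :=
  fun i j => if h : (i, j) ∈ nilRoots c then MvPolynomial.X ⟨(i, j), h⟩ else 0

variable {K}

/-- The matrix `g⁻¹ 𝕏 g`, where `𝕏` is the generic matrix of `𝔪`. -/
noncomputable def conjGeneric (c : Composition n) (g : borel K n) :
    Matrix (Fin n) (Fin n) (NilPoly K c) :=
  ((g⁻¹ : GL (Fin n) K) : Matrix (Fin n) (Fin n) K).map MvPolynomial.C * genericMatrix K c *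
    ((g : GL (Fin n) K) : Matrix (Fin n) (Fin n) K).map MvPolynomial.C

/-- The map `f(x) ↦ f(Ad_{g⁻¹} x)` of `K[𝔪]`, that is, the substitution of the entries of
`g⁻¹ 𝕏 g` for those of `𝕏`. -/
noncomputable def substPoly (c : Composition n) (g : borel K n) : NilPoly K c →ₐ[K] NilPoly K c :=
  MvPolynomial.aeval fun γ => conjGeneric c g γ.1.1 γ.1.2

theorem index_mono (c : Composition n) {i j : Fin n} (h : i ≤ j) : c.index i ≤ c.index j := by
  by_contra hlt
  have h1 : (c.index j).succ.val ≤ (c.index i : ℕ) := by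
    simpa using Nat.succ_le_of_lt (not_le.mp hlt)
  have h2 := c.lt_sizeUpTo_index_succ j
  have h3 := c.sizeUpTo_index_le i
  have h4 := c.monotone_sizeUpTo h1
  have h5 : (i : ℕ) ≤ j := h
  omega

theorem conjGeneric_eq_zero (c : Composition n) (g : borel K n) {i j : Fin n}
    (h : (i, j) ∉ nilRoots c) : conjGeneric c g i j = 0 := by
  have hg : ((g : GL (Fin n) K) : Matrix (Fin n) (Fin n) K).BlockTriangular id := g.2
  have hg' : ((g⁻¹ : GL (Fin n) K) : Matrix (Fin n) (Fin n) K).BlockTriangular id :=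
    (g⁻¹).2
  simp only [conjGeneric, Matrix.mul_apply, Matrix.map_apply]
  refine Finset.sum_eq_zero fun l _ => ?_
  rcases lt_or_ge j l with hl | hl
  · rw [hg hl, map_zero, mul_zero]
  · refine mul_eq_zero_of_left (Finset.sum_eq_zero fun k _ => ?_) _
    rcases lt_or_ge k i with hk | hk
    · rw [hg' hk, map_zero, zero_mul]
    · refine mul_eq_zero_of_right _ (dif_neg fun hkl => h ?_)
      exact ((index_mono c hk).trans_lt hkl).trans_le (index_mono c hl)

theorem genericMatrix_map_substPoly (c : Composition n) (g : borel K n) :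
    (genericMatrix K c).map (substPoly c g) = conjGeneric c g := by
  ext1 i j
  by_cases h : (i, j) ∈ nilRoots c
  · simp [genericMatrix, h, substPoly]
  · simp [genericMatrix, h, conjGeneric_eq_zero c g h]

theorem substPoly_one (c : Composition n) : substPoly c (1 : borel K n) = AlgHom.id K _ := by
  ext1 γ
  have h1 : (1 : Matrix (Fin n) (Fin n) K).map (MvPolynomial.C : K →+* NilPoly K c) = 1 :=
    Matrix.map_one _ (map_zero _) (map_one _)
  simp [substPoly, conjGeneric, h1, genericMatrix]

theorem substPoly_mul (c : Composition n) (g h : borel K n) :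
    substPoly c (g * h) = (substPoly c g).comp (substPoly c h) := by
  ext1 γ
  have key : (conjGeneric c h).map (substPoly c g) = conjGeneric c (g * h) := by
    have hC : ∀ A : Matrix (Fin n) (Fin n) K,
        (A.map (MvPolynomial.C : K →+* NilPoly K c)).map (substPoly c g) =
          A.map MvPolynomial.C := by
      intro A
      ext1 i j
      exact (substPoly c g).commutes (A i j)
    rw [conjGeneric, Matrix.map_mul, Matrix.map_mul, hC, hC, genericMatrix_map_substPoly,
      conjGeneric, conjGeneric, Subgroup.coe_mul, mul_inv_rev, Units.val_mul, Units.val_mul]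
    rw [Matrix.map_mul, Matrix.map_mul]
    simp only [Matrix.mul_assoc]
  have := congrFun (congrFun key γ.1.1) γ.1.2
  simpa [substPoly] using this.symm

/-- The action of `B` on `K[𝔪]` by `(g • f)(x) = f(Ad_{g⁻¹} x)`. -/
noncomputable def borelActPoly (c : Composition n) :
    borel K n →* (NilPoly K c ≃ₐ[K] NilPoly K c) where
  toFun g := AlgEquiv.ofAlgHom (substPoly c g) (substPoly c g⁻¹)
    (by rw [← substPoly_mul, mul_inv_cancel, substPoly_one])
    (by rw [← substPoly_mul, inv_mul_cancel, substPoly_one])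
  map_one' := by
    ext1 f
    exact DFunLike.congr_fun (substPoly_one c) f
  map_mul' g h := by
    ext1 f
    exact DFunLike.congr_fun (substPoly_mul c g h) f

/-- The induced action of `B` on `K(𝔪)`. -/
noncomputable def borelAct (c : Composition n) :
    borel K n →* (NilField K c ≃ₐ[K] NilField K c) :=
  (IsFractionRing.fieldEquivOfAlgEquivHom K (NilField K c)).comp (borelActPoly c)

variable (K)

/-- The field of invariants `K(𝔪)^B`. -/
noncomputable def borelInvariants (c : Composition n) : IntermediateField K (NilField K c) :=
  IntermediateField.fixedField (borelAct (K := K) c).range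

/-- The polynomial algebra `K[𝒳]` in the variables `c_ψ`, `ψ ∈ Ψ`. -/
abbrev CanonPoly (c : Composition n) : Type _ := MvPolynomial (psi c) K

/-- The field of fractions `K(𝒳)` of `K[𝒳]`. -/
abbrev CanonField (c : Composition n) : Type _ := FractionRing (CanonPoly K c)

open Classical in
/-- The restriction of polynomial functions on `𝔪` to the set `𝒳` of canonical matrices: `x_ξ` goes
to `c_ξ` if `ξ ∈ Ψ`, to `1` if `ξ` is another root of the extended base, and to `0` otherwise. -/
noncomputable def restrictPoly (c : Composition n) : NilPoly K c →ₐ[K] CanonPoly K c :=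
  MvPolynomial.aeval fun ξ =>
    if h : ξ.1 ∈ psi c then MvPolynomial.X ⟨ξ.1, h⟩ else if ξ.1 ∈ extBase c then 1 else 0

/-- The polynomials on `𝔪` that do not vanish identically on `𝒳`. -/
noncomputable def nonvanishing (c : Composition n) : Submonoid (NilPoly K c) :=
  (nonZeroDivisors (CanonPoly K c)).comap (restrictPoly K c)

theorem nonvanishing_le (c : Composition n) :
    nonvanishing K c ≤ nonZeroDivisors (NilPoly K c) := by
  intro q hq
  have hq' : restrictPoly K c q ≠ 0 := nonZeroDivisors.ne_zero hq
  exact mem_nonZeroDivisors_of_ne_zero fun h => hq' (by rw [h, map_zero])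

/-- The rational functions on `𝔪` that can be restricted to `𝒳`: the fractions `p / q` such that
`q` does not vanish identically on `𝒳`. -/
noncomputable def restrictable (c : Composition n) : Subalgebra (NilPoly K c) (NilField K c) :=
  Localization.subalgebra.ofField (NilField K c) (nonvanishing K c) (nonvanishing_le K c)

noncomputable instance (c : Composition n) :
    IsLocalization (nonvanishing K c) (restrictable K c) :=
  Localization.subalgebra.isLocalization_ofField _ _ _

/-- The restriction of rational functions to `𝒳`, `p / q ↦ p|_𝒳 / q|_𝒳`. -/
noncomputable def restrict (c : Composition n) : restrictable K c →ₐ[K] CanonField K c :=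
  IsLocalization.liftAlgHom (M := nonvanishing K c)
    (f := (IsScalarTower.toAlgHom K (CanonPoly K c) (CanonField K c)).comp (restrictPoly K c))
    fun q => IsLocalization.map_units (CanonField K c)
      (⟨restrictPoly K c q, q.2⟩ : nonZeroDivisors (CanonPoly K c))

end Invariants

end BorelNilradical

namespace BorelNilradical

/-! ### The base as the kernel of the root relation, and the shape of `S ∪ Φ`. -/

section Kernel

variable {n : ℕ}

/-! Write `B = TU` with `T` diagonal and `U` unitriangular, and let `G` be the generic matrix over
`K(𝔪)`.

The unipotent part. `G` is `U`-conjugate over `K(𝔪)` to a matrix `y` supported on `S ∪ Φ` and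
nonzero on `S` (`exists_genericField_uniConj`). This is an elimination column by column
(`exists_normal_succ`). It needs two conditions that are stable under `U`: `Rich`, which lets a
conjugation act on one column without disturbing the columns before it, and `CornerRank`, which
makes the pivots nonzero. Both hold for `G` because a determinant does not vanish at one special
matrix: the line diagram, respectively the base. The normal form is unique, and an upper triangular
matrix conjugating two normal forms acts on their entries only through its diagonal
(`conj_diag_of_conj`). Hence `(u, y) ↦ u y u⁻¹` is dominant (`paramMap_injective`), and in its
coordinates the entries of the normal form of `G` on `S ∪ Φ` are independent variables
(`map_paramFieldMap_eq`).

The torus. Regard a root `(i, j)` as an edge between `i` and `j`; `T` acts on the entry there by the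
character of the edge. The edges of `(S ∪ Φ) \ Ψ` form a forest, so a diagonal conjugation turns
these entries into ones (`exists_sub_eq_on_tree`, `canon_tree`). The two ends of a root of `Ψ` lie
in the same component (`eq_on_psi`), so the remaining entries become `B`-invariant
(`canon_mem_borelInvariants`). Both facts rest on explicit descriptions of `S`, `Φ` and `Ψ` in terms
of block sizes (`mem_base_iff_isPred`, `mem_phi_iff_isPred`, `mem_psi_iff`).

Restriction. The `B`-conjugates of `𝒳` are dense, so the denominator of a reduced invariant
fraction, which divides its own translates, cannot vanish on `𝒳`
(`eq_zero_of_restrictPoly_eq_zero`). Restriction is then a homomorphism of fields, hence injective.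
It sends the canonical entry at `ψ` to `c_ψ` (`restrictPoly_of_canon`), and these generate `K(𝒳)`,
so it is surjective. -/

theorem rootGT_iff {γ ξ : Fin n × Fin n} (hγ : γ.1 < γ.2) (hξ : ξ.1 < ξ.2) :
    RootGT γ ξ ↔ (γ.1 = ξ.1 ∧ ξ.2 < γ.2) ∨ (γ.2 = ξ.2 ∧ γ.1 < ξ.1) := by
  obtain ⟨a, b⟩ := γ
  obtain ⟨c, d⟩ := ξ
  simp only at hγ hξ ⊢
  constructor
  · rintro ⟨⟨e, f⟩, hδ, h⟩
    have hef : e < f := hδ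
    simp only [rootVec, funext_iff, Pi.sub_apply, Pi.single_apply] at h
    have ha := h a
    have hb := h b
    have hc := h c
    have hd := h d
    have he := h e
    have hf := h f
    grind
  · rintro (⟨rfl, h⟩ | ⟨rfl, h⟩)
    · exact ⟨(d, b), h, by simp [rootVec]⟩
    · exact ⟨(a, c), h, by simp [rootVec]⟩

theorem index_lt_iff_lt {c : Composition n} {i j : Fin n} (h : c.index i < c.index j) : i < j := by
  by_contra hlt
  exact absurd (index_mono c (not_lt.mp hlt)) (not_le.mpr h)

theorem nilRoots_lt {c : Composition n} {γ : Fin n × Fin n} (h : γ ∈ nilRoots c) : γ.1 < γ.2 :=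
  index_lt_iff_lt h

theorem remainingRoots_subset (c : Composition n) (k : ℕ) : remainingRoots c k ⊆ nilRoots c := by
  induction k with
  | zero => exact subset_rfl
  | succ k ih => exact Set.sdiff_subset.trans ih

theorem remainingRoots_anti (c : Composition n) : Antitone (remainingRoots c) :=
  antitone_nat_of_succ_le fun _ => Set.sdiff_subset

theorem base_subset (c : Composition n) : base c ⊆ nilRoots c :=
  Set.iUnion_subset fun k _ h => remainingRoots_subset c k h.1

/-- The height of a root. -/
def height (γ : Fin n × Fin n) : ℕ := γ.2 - γ.1

theorem height_lt_of_rootGT {γ ξ : Fin n × Fin n} (hγ : γ.1 < γ.2) (hξ : ξ.1 < ξ.2)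
    (h : RootGT γ ξ) : height ξ < height γ := by
  rw [rootGT_iff hγ hξ] at h
  unfold height
  simp only [Fin.lt_def, Fin.ext_iff] at *
  omega

theorem minimalRoots_nonempty {A : Set (Fin n × Fin n)} (hA : ∀ γ ∈ A, γ.1 < γ.2)
    (hne : A.Nonempty) : (minimalRoots A).Nonempty := by
  obtain ⟨γ, hγ, hmin⟩ := (measure (height (n := n))).wf.has_min A hne
  exact ⟨γ, hγ, fun ⟨ξ, hξ, hgt⟩ => hmin ξ hξ (height_lt_of_rootGT (hA γ hγ) (hA ξ hξ) hgt)⟩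

theorem exists_remainingRoots_empty (c : Composition n) : ∃ k, remainingRoots c k = ∅ := by
  by_contra! hne
  have hcard : ∀ k, (remainingRoots c k).ncard + k ≤ (remainingRoots c 0).ncard := by
    intro k
    induction k with
    | zero => simp
    | succ k ih =>
      obtain ⟨γ, hγ⟩ := minimalRoots_nonempty
        (fun γ h => nilRoots_lt (remainingRoots_subset c k h)) (hne k)
      have : (remainingRoots c (k + 1)).ncard < (remainingRoots c k).ncard := by
        refine Set.ncard_lt_ncard ⟨Set.sdiff_subset, fun h => ?_⟩ (Set.toFinite _)
        exact (h hγ.1).2 (Or.inl hγ)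
      omega
  have := hcard ((remainingRoots c 0).ncard + 1)
  omega

/-- A root leaves the process only by being collected or because a collected root lies below it, and
the process exhausts `𝔪`. This fixed-point form replaces the rounds from here on; since `RootGT`
increases the height, it also determines the base. -/
theorem mem_base_iff (c : Composition n) (γ : Fin n × Fin n) :
    γ ∈ base c ↔ γ ∈ nilRoots c ∧ ∀ ξ ∈ base c, ¬ RootGT γ ξ := by
  constructor
  · intro h
    refine ⟨base_subset c h, fun ξ hξ hgt => ?_⟩
    obtain ⟨k, hk⟩ := Set.mem_iUnion.mp h
    obtain ⟨l, hl⟩ := Set.mem_iUnion.mp hξ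
    rcases lt_or_ge l k with hlk | hkl
    · exact (remainingRoots_anti c hlk hk.1).2
        (Or.inr ⟨remainingRoots_anti c hlk.le hk.1, ξ, hl, hgt⟩)
    · exact hk.2 ⟨ξ, remainingRoots_anti c hkl hl.1, hgt⟩
  · rintro ⟨hM, hno⟩
    by_contra hb
    have hall : ∀ k, γ ∈ remainingRoots c k := by
      intro k
      induction k with
      | zero => exact hM
      | succ k ih =>
        refine ⟨ih, ?_⟩
        rintro (h | ⟨-, ξ, hξ, hgt⟩)
        · exact hb (Set.mem_iUnion.mpr ⟨k, h⟩)
        · exact hno ξ (Set.mem_iUnion.mpr ⟨k, hξ⟩) hgt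
    obtain ⟨k, hk⟩ := exists_remainingRoots_empty c
    exact (hk ▸ hall k : γ ∈ (∅ : Set _))

/-- The base is the only kernel of the relation `RootGT` on the roots of `𝔪`. -/
theorem eq_base_of_kernel (c : Composition n) (A : Set (Fin n × Fin n))
    (hA : ∀ γ, γ ∈ A ↔ γ ∈ nilRoots c ∧ ∀ ξ ∈ A, ¬ RootGT γ ξ) : A = base c := by
  have key : ∀ N, ∀ γ : Fin n × Fin n, height γ < N → (γ ∈ A ↔ γ ∈ base c) := by
    intro N
    induction N with
    | zero => intro γ h; omega
    | succ N ih =>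
      intro γ hN
      rw [hA, mem_base_iff]
      refine and_congr_right fun hγ => ?_
      have hh : ∀ ξ, ξ ∈ nilRoots c → RootGT γ ξ → (ξ ∈ A ↔ ξ ∈ base c) := fun ξ hξ hgt =>
        ih ξ (by have := height_lt_of_rootGT (nilRoots_lt hγ) (nilRoots_lt hξ) hgt; omega)
      constructor
      · intro h ξ hξ hgt
        exact h ξ ((hh ξ (base_subset c hξ) hgt).mpr hξ) hgt
      · intro h ξ hξ hgt
        exact h ξ ((hh ξ ((hA ξ).mp hξ).1 hgt).mp hξ) hgt
  ext γ
  exact key _ γ (Nat.lt_succ_self _)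

variable {c : Composition n}

theorem base_index_lt {i j : Fin n} (h : (i, j) ∈ base c) : c.index i < c.index j :=
  base_subset c h

theorem base_lt {i j : Fin n} (h : (i, j) ∈ base c) : i < j := nilRoots_lt (base_subset c h)

theorem not_base_of_row {i j l : Fin n} (h : (i, l) ∈ base c) (hlj : l < j) :
    (i, j) ∉ base c := fun h' =>
  ((mem_base_iff c _).mp h').2 _ h ((rootGT_iff (base_lt h') (base_lt h)).mpr (Or.inl ⟨rfl, hlj⟩))

theorem not_base_of_col {i j k : Fin n} (h : (k, j) ∈ base c) (hik : i < k) :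
    (i, j) ∉ base c := fun h' =>
  ((mem_base_iff c _).mp h').2 _ h ((rootGT_iff (base_lt h') (base_lt h)).mpr (Or.inr ⟨rfl, hik⟩))

theorem base_row_unique {i j l : Fin n} (h : (i, j) ∈ base c) (h' : (i, l) ∈ base c) : j = l := by
  rcases lt_trichotomy j l with hlt | rfl | hlt
  · exact absurd h' (not_base_of_row h hlt)
  · rfl
  · exact absurd h (not_base_of_row h' hlt)

theorem base_col_unique {i j k : Fin n} (h : (i, j) ∈ base c) (h' : (k, j) ∈ base c) : i = k := by
  rcases lt_trichotomy i k with hlt | rfl | hlt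
  · exact absurd h (not_base_of_col h' hlt)
  · rfl
  · exact absurd h' (not_base_of_col h hlt)

theorem base_cases {i j : Fin n} (h : c.index i < c.index j) :
    (i, j) ∈ base c ∨ (∃ l < j, (i, l) ∈ base c) ∨ ∃ k, i < k ∧ (k, j) ∈ base c := by
  by_contra! hno
  obtain ⟨h1, h2, h3⟩ := hno
  refine h1 ((mem_base_iff c _).mpr ⟨h, ?_⟩)
  rintro ⟨k, l⟩ hξ hgt
  rw [rootGT_iff (index_lt_iff_lt h) (base_lt hξ)] at hgt
  rcases hgt with ⟨rfl, hl⟩ | ⟨rfl, hk⟩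
  · exact h2 l hl hξ
  · exact h3 k hk hξ

/-- Within a block of rows the columns of the base decrease. -/
theorem base_row_anti {i k j l : Fin n} (h : (i, j) ∈ base c) (h' : (k, l) ∈ base c)
    (hik : i < k) (hβ : c.index i = c.index k) : l < j := by
  -- The corner `(k, j)` is again a root of `𝔪`. Column `j` has its base root in the row `i < k`, so
  -- only a base root of row `k` to the left of `j` can dominate this corner.
  rcases base_cases (c := c) (i := k) (j := j) (hβ ▸ base_index_lt h) with
    h1 | ⟨l', hl', h1⟩ | ⟨k', hk', h1⟩
  · exact absurd (base_col_unique h h1) hik.ne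
  · rwa [base_row_unique h' h1]
  · exact absurd (base_col_unique h h1) (hik.trans hk').ne

/-- Within a block of columns the rows of the base decrease. -/
theorem base_col_anti {i k j l : Fin n} (h : (i, j) ∈ base c) (h' : (k, l) ∈ base c)
    (hjl : j < l) (hβ : c.index j = c.index l) : k < i := by
  rcases base_cases (c := c) (i := k) (j := j) (hβ ▸ base_index_lt h') with
    h1 | ⟨l', hl', h1⟩ | ⟨k', hk', h1⟩
  · exact absurd (base_row_unique h1 h') hjl.ne
  · exact absurd (base_row_unique h1 h') (hl'.trans hjl).ne
  · rwa [base_col_unique h h1]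

theorem mem_phi_iff {j l : Fin n} :
    (j, l) ∈ phi c ↔ (∃ i, (i, j) ∈ base c) ∧
      ∃ k, j < k ∧ c.index j = c.index k ∧ (k, l) ∈ base c := by
  constructor
  · rintro ⟨i, j', k, l', h1, h2, h3, h4⟩
    obtain ⟨rfl, rfl⟩ := Prod.mk.inj h4
    exact ⟨⟨i, h1⟩, k, h3.1, h3.2, h2⟩
  · rintro ⟨⟨i, h1⟩, k, h2, h3, h4⟩
    exact ⟨i, j, k, l, h1, h4, ⟨h2, h3⟩, rfl⟩

/-- Every root of the extended base is at or above a root of the base in its column. -/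
theorem extBase_col {j l : Fin n} (h : (j, l) ∈ extBase c) :
    ∃ k, j ≤ k ∧ c.index j = c.index k ∧ (k, l) ∈ base c ∧ (j = k ∨ ∃ i, (i, j) ∈ base c) := by
  rcases h with h | h
  · exact ⟨j, le_rfl, rfl, h, Or.inl rfl⟩
  · obtain ⟨h1, k, hk, hβ, h2⟩ := mem_phi_iff.mp h
    exact ⟨k, hk.le, hβ, h2, Or.inr h1⟩

theorem extBase_subset (c : Composition n) : extBase c ⊆ nilRoots c := by
  rintro ⟨j, l⟩ h
  obtain ⟨k, -, hβ, hk, -⟩ := extBase_col h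
  change c.index j < c.index l
  rw [hβ]
  exact base_index_lt hk

theorem extBase_index_lt {i j : Fin n} (h : (i, j) ∈ extBase c) : c.index i < c.index j :=
  extBase_subset c h

end Kernel

/-! ### Uniqueness of the normal form under the unitriangular group. -/

section Uniqueness

variable {n : ℕ}

/-- The matrices supported on the extended base. -/
def ExtSupported {R : Type*} [CommRing R] (c : Composition n) (Y : Matrix (Fin n) (Fin n) R) :
    Prop :=
  ∀ i j, (i, j) ∉ extBase c → Y i j = 0

variable {F : Type*} [Field F]

/-- The matrices with nonzero entries at the base. -/
def BaseNonzero (c : Composition n) (Y : Matrix (Fin n) (Fin n) F) : Prop :=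
  ∀ i j, (i, j) ∈ base c → Y i j ≠ 0

variable {c : Composition n} {Z Y g : Matrix (Fin n) (Fin n) F}

/-- Compare the entries of `Z g = g Y` at `(a, q)`. On the right, column `q` of `Y` vanishes from
row `a` downwards. On the left, the entries of row `a` of `Z` other than the base entry lie over
base roots further down the block, hence in columns before `j`, where induction applies. What
remains is `Z a j * g j q = 0`. -/
theorem conj_entry_eq_zero (hZ : ExtSupported c Z) (hZ0 : BaseNonzero c Z) (hY : ExtSupported c Y)
    (hg : ∀ i j, j < i → g i j = 0) (h : Z * g = g * Y) {q : Fin n} (j : Fin n) :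
    ∀ a, (a, j) ∈ base c → j < q → (∀ b, (b, q) ∈ base c → b < a) → g j q = 0 := by
  induction j using WellFoundedLT.induction with
  | _ j ih =>
    intro a haj hjq hb
    have h1 := congrFun (congrFun h a) q
    rw [Matrix.mul_apply, Matrix.mul_apply] at h1
    have hR : ∑ p, g a p * Y p q = 0 := by
      refine Finset.sum_eq_zero fun p _ => ?_
      by_cases hp : p < a
      · rw [hg _ _ hp, zero_mul]
      · by_cases hpq : (p, q) ∈ extBase c
        · obtain ⟨k, hk, -, hkq, -⟩ := extBase_col hpq
          exact absurd (hb k hkq) (not_lt.mpr ((not_lt.mp hp).trans hk))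
        · rw [hY _ _ hpq, mul_zero]
    have hL : ∑ p, Z a p * g p q = Z a j * g j q := by
      refine Finset.sum_eq_single j (fun p _ hpj => ?_) (by simp)
      by_cases hap : (a, p) ∈ extBase c
      · obtain ⟨k, hk, hβ, hkp, -⟩ := extBase_col hap
        rcases hk.eq_or_lt with rfl | hk
        · exact absurd (base_row_unique hkp haj) hpj
        · have hpj' := base_row_anti haj hkp hk hβ
          rw [ih p hpj' k hkp (hpj'.trans hjq) fun b hbq => (hb b hbq).trans hk, mul_zero]
      · rw [hZ _ _ hap, zero_mul]
    rw [hL, hR] at h1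
    exact (mul_eq_zero.mp h1).resolve_left (hZ0 _ _ haj)

/-- If an upper triangular matrix conjugates two matrices supported on the extended base, then so
does its diagonal part. -/
theorem conj_diag_of_conj (hZ : ExtSupported c Z) (hZ0 : BaseNonzero c Z) (hY : ExtSupported c Y)
    (hg : ∀ i j, j < i → g i j = 0) (h : Z * g = g * Y) {j l : Fin n} (hjl : (j, l) ∈ extBase c) :
    Z j l * g l l = g j j * Y j l := by
  obtain ⟨k, hjk, hβ, hkl, hC⟩ := extBase_col hjl
  have h1 := congrFun (congrFun h j) l
  rw [Matrix.mul_apply, Matrix.mul_apply] at h1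
  have hL : ∑ p, Z j p * g p l = Z j l * g l l := by
    refine Finset.sum_eq_single l (fun p _ hpl => ?_) (by simp)
    by_cases hp : l < p
    · rw [hg _ _ hp, mul_zero]
    · have hpl' : p < l := lt_of_le_of_ne (not_lt.mp hp) hpl
      by_cases hjp : (j, p) ∈ extBase c
      · obtain ⟨k', hk', hβ', hkp, -⟩ := extBase_col hjp
        have hkk : k < k' := by
          rcases lt_trichotomy k k' with hlt | rfl | hlt
          · exact hlt
          · exact absurd (base_row_unique hkp hkl) hpl
          · exact absurd (base_row_anti hkp hkl hlt (hβ'.symm.trans hβ)) hpl'.not_gt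
        rw [conj_entry_eq_zero hZ hZ0 hY hg h p k' hkp hpl' fun b hb =>
          (base_col_unique hb hkl).trans_lt hkk, mul_zero]
      · rw [hZ _ _ hjp, zero_mul]
  have hR : ∑ p, g j p * Y p l = g j j * Y j l := by
    refine Finset.sum_eq_single j (fun p _ hpj => ?_) (by simp)
    by_cases hp : p < j
    · rw [hg _ _ hp, zero_mul]
    · have hjp : j < p := lt_of_le_of_ne (not_lt.mp hp) (Ne.symm hpj)
      by_cases hpl : (p, l) ∈ extBase c
      · obtain ⟨k', hk', hβ', hkl', -⟩ := extBase_col hpl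
        obtain rfl := base_col_unique hkl' hkl
        rcases hC with rfl | ⟨a, ha⟩
        · exact absurd hk' (not_le.mpr hjp)
        · rw [conj_entry_eq_zero hZ hZ0 hY hg h j a ha hjp fun b hb =>
            base_col_anti ha hb hjp (hβ.trans hβ'.symm), zero_mul]
      · rw [hY _ _ hpl, mul_zero]
  rwa [hL, hR] at h1

/-- Matrices supported on the extended base that are conjugate by a unitriangular matrix are
equal. -/
theorem eq_of_unitriangular_conj (hZ : ExtSupported c Z) (hZ0 : BaseNonzero c Z)
    (hY : ExtSupported c Y) (hg : ∀ i j, j < i → g i j = 0) (hg1 : ∀ i, g i i = 1)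
    (h : Z * g = g * Y) : Z = Y := by
  ext j l
  by_cases hjl : (j, l) ∈ extBase c
  · simpa [hg1] using conj_diag_of_conj hZ hZ0 hY hg h hjl
  · rw [hZ _ _ hjl, hY _ _ hjl]

end Uniqueness

/-! ### Unitriangular matrices and conjugacy under them. -/

section Unitriangular

variable {n : ℕ} {F : Type*} [CommRing F]

/-- The upper triangular matrices with ones on the diagonal. -/
def IsUnitri (g : Matrix (Fin n) (Fin n) F) : Prop :=
  (∀ i j, j < i → g i j = 0) ∧ ∀ i, g i i = 1

theorem upper_mul {g h : Matrix (Fin n) (Fin n) F} (hg : ∀ i j, j < i → g i j = 0)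
    (hh : ∀ i j, j < i → h i j = 0) : ∀ i j, j < i → (g * h) i j = 0 := by
  intro i j hij
  rw [Matrix.mul_apply]
  refine Finset.sum_eq_zero fun k _ => ?_
  rcases lt_or_ge k i with hk | hk
  · rw [hg _ _ hk, zero_mul]
  · rw [hh _ _ (hij.trans_le hk), mul_zero]

theorem upper_mul_diag {g h : Matrix (Fin n) (Fin n) F} (hg : ∀ i j, j < i → g i j = 0)
    (hh : ∀ i j, j < i → h i j = 0) (i : Fin n) : (g * h) i i = g i i * h i i := by
  rw [Matrix.mul_apply]
  refine Finset.sum_eq_single i (fun k _ hk => ?_) (by simp)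
  rcases hk.lt_or_gt with hk | hk
  · rw [hg _ _ hk, zero_mul]
  · rw [hh _ _ hk, mul_zero]

theorem IsUnitri.one : IsUnitri (1 : Matrix (Fin n) (Fin n) F) :=
  ⟨fun _ _ h => Matrix.one_apply_ne h.ne', fun i => Matrix.one_apply_eq i⟩

theorem IsUnitri.mul {g h : Matrix (Fin n) (Fin n) F} (hg : IsUnitri g) (hh : IsUnitri h) :
    IsUnitri (g * h) :=
  ⟨upper_mul hg.1 hh.1, fun i => by rw [upper_mul_diag hg.1 hh.1, hg.2, hh.2, one_mul]⟩

theorem IsUnitri.det {g : Matrix (Fin n) (Fin n) F} (hg : IsUnitri g) : g.det = 1 := by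
  rw [Matrix.det_of_isUpperTriangular (fun i j h => hg.1 i j h)]
  exact Finset.prod_eq_one fun i _ => hg.2 i

theorem IsUnitri.exists_inv {g : Matrix (Fin n) (Fin n) F} (hg : IsUnitri g) :
    ∃ g', IsUnitri g' ∧ g * g' = 1 ∧ g' * g = 1 := by
  have hu : IsUnit g.det := by rw [hg.det]; exact isUnit_one
  have : Invertible g := Matrix.invertibleOfIsUnitDet g hu
  have hup : ∀ i j, j < i → g⁻¹ i j = 0 := fun i j h =>
    Matrix.blockTriangular_inv_of_blockTriangular (M := g) (b := id) (fun i j h => hg.1 i j h) h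
  refine ⟨g⁻¹, ⟨hup, fun i => ?_⟩, Matrix.mul_nonsing_inv g hu, Matrix.nonsing_inv_mul g hu⟩
  have := upper_mul_diag hg.1 hup i
  rw [Matrix.mul_nonsing_inv g hu, hg.2, one_mul, Matrix.one_apply_eq] at this
  exact this.symm

/-- Conjugacy under the unitriangular group. -/
def UniConj (x y : Matrix (Fin n) (Fin n) F) : Prop :=
  ∃ g g', IsUnitri g ∧ IsUnitri g' ∧ g * g' = 1 ∧ g' * g = 1 ∧ y = g' * x * g

theorem UniConj.refl (x : Matrix (Fin n) (Fin n) F) : UniConj x x :=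
  ⟨1, 1, .one, .one, by simp, by simp, by simp⟩

theorem UniConj.trans {x y z : Matrix (Fin n) (Fin n) F} (h : UniConj x y) (h' : UniConj y z) :
    UniConj x z := by
  obtain ⟨g, g', hg, hg', h1, h2, rfl⟩ := h
  obtain ⟨k, k', hk, hk', h3, h4, rfl⟩ := h'
  refine ⟨g * k, k' * g', hg.mul hk, hk'.mul hg', ?_, ?_, by noncomm_ring⟩
  · rw [Matrix.mul_assoc, ← Matrix.mul_assoc k, h3, Matrix.one_mul, h1]
  · rw [Matrix.mul_assoc, ← Matrix.mul_assoc g', h2, Matrix.one_mul, h4]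

end Unitriangular

/-! ### The condition `Rich` and its invariance under conjugation. -/

section Conditions

variable {n : ℕ} {F : Type*} [CommRing F]

/-- The matrices of the nilradical. -/
def IsNil (c : Composition n) (x : Matrix (Fin n) (Fin n) F) : Prop :=
  ∀ i j, ¬ c.index i < c.index j → x i j = 0

/-- The matrices of the parabolic subalgebra. -/
def IsPar (c : Composition n) (x : Matrix (Fin n) (Fin n) F) : Prop :=
  ∀ i j, c.index j < c.index i → x i j = 0

variable {c : Composition n}

theorem isPar_of_upper {g : Matrix (Fin n) (Fin n) F} (hg : ∀ i j, j < i → g i j = 0) :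
    IsPar c g := fun _ _ h => hg _ _ (index_lt_iff_lt h)

theorem IsPar.mul {x y : Matrix (Fin n) (Fin n) F} (hx : IsPar c x) (hy : IsPar c y) :
    IsPar c (x * y) := fun i j h => by
  rw [Matrix.mul_apply]
  refine Finset.sum_eq_zero fun k _ => ?_
  rcases lt_or_ge (c.index k) (c.index i) with hk | hk
  · rw [hx _ _ hk, zero_mul]
  · rw [hy _ _ (h.trans_le hk), mul_zero]

theorem IsPar.mul_isNil {x y : Matrix (Fin n) (Fin n) F} (hx : IsPar c x) (hy : IsNil c y) :
    IsNil c (x * y) := fun i j h => by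
  rw [Matrix.mul_apply]
  refine Finset.sum_eq_zero fun k _ => ?_
  rcases lt_or_ge (c.index k) (c.index i) with hk | hk
  · rw [hx _ _ hk, zero_mul]
  · rw [hy _ _ fun h' => h (hk.trans_lt h'), mul_zero]

theorem IsNil.mul_isPar {x y : Matrix (Fin n) (Fin n) F} (hx : IsNil c x) (hy : IsPar c y) :
    IsNil c (x * y) := fun i j h => by
  rw [Matrix.mul_apply]
  refine Finset.sum_eq_zero fun k _ => ?_
  rcases lt_or_ge (c.index j) (c.index k) with hk | hk
  · rw [hy _ _ hk, mul_zero]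
  · rw [hx _ _ fun h' => h (h'.trans_le hk), zero_mul]

theorem UniConj.isNil {x y : Matrix (Fin n) (Fin n) F} (h : UniConj x y) (hx : IsNil c x) :
    IsNil c y := by
  obtain ⟨g, g', hg, hg', -, -, rfl⟩ := h
  exact ((isPar_of_upper hg'.1).mul_isNil hx).mul_isPar (isPar_of_upper hg.1)

/-- The adjoint map `N ↦ [N, x]` from the part of the parabolic subalgebra with rows and columns
less than `m` to the columns less than `m` of the nilradical is surjective. -/
def Rich (c : Composition n) (x : Matrix (Fin n) (Fin n) F) (m : Fin n) : Prop :=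
  ∀ Z : Matrix (Fin n) (Fin n) F, IsNil c Z → ∃ N : Matrix (Fin n) (Fin n) F, IsPar c N ∧
    (∀ i j, m ≤ i ∨ m ≤ j → N i j = 0) ∧ ∀ i j, j < m → (N * x - x * N) i j = Z i j

theorem IsNil.upper {x : Matrix (Fin n) (Fin n) F} (hx : IsNil c x) :
    ∀ i j, j < i → x i j = 0 :=
  fun _ _ h => hx _ _ fun h' => lt_asymm h (index_lt_iff_lt h')

/-- Upper triangular matrices preserve the span of the first `m` basis vectors: with `e` the
projection onto it, `e A e = A e`. So a solution `N` for `x` can be conjugated and cut down to `g' N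
g e`, and its commutator changes only in columns outside the condition. -/
theorem UniConj.rich {x y : Matrix (Fin n) (Fin n) F} (h : UniConj x y) {m : Fin n}
    (hnil : IsNil c x) (hx : Rich c x m) : Rich c y m := by
  have hy := (h.isNil hnil).upper
  obtain ⟨g, g', hg, hg', h1, h2, rfl⟩ := h
  intro Z hZ
  obtain ⟨N, hN, hN0, hNZ⟩ := hx (g * Z * g')
    (((isPar_of_upper hg.1).mul_isNil hZ).mul_isPar (isPar_of_upper hg'.1))
  set e : Matrix (Fin n) (Fin n) F := Matrix.diagonal fun i => if i < m then 1 else 0 with he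
  have hmul : ∀ (A : Matrix (Fin n) (Fin n) F) i j, (A * e) i j = if j < m then A i j else 0 := by
    intro A i j
    rw [he, Matrix.mul_diagonal]
    split_ifs <;> simp
  have hmul' : ∀ (A : Matrix (Fin n) (Fin n) F) i j, (e * A) i j = if i < m then A i j else 0 := by
    intro A i j
    rw [he, Matrix.diagonal_mul]
    split_ifs <;> simp
  have hup : ∀ A : Matrix (Fin n) (Fin n) F, (∀ i j, j < i → A i j = 0) → e * A * e = A * e := by
    intro A hA
    ext i j
    rw [hmul, hmul', hmul]
    by_cases hj : j < m <;> simp only [hj, if_true, if_false]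
    by_cases hi : i < m <;> simp only [hi, if_true, if_false]
    exact (hA _ _ (hj.trans_le (not_lt.mp hi))).symm
  have hee : e * e = e := by
    ext i j
    rw [hmul, he]
    by_cases hij : i = j
    · subst hij
      rw [Matrix.diagonal_apply_eq]
      split_ifs <;> rfl
    · simp [hij]
  have hNe : N * e = N := by
    ext i j
    rw [hmul]
    split_ifs with hj
    · rfl
    · exact (hN0 _ _ (Or.inr (not_lt.mp hj))).symm
  have hNe' : e * N = N := by
    ext i j
    rw [hmul']
    split_ifs with hj
    · rfl
    · exact (hN0 _ _ (Or.inl (not_lt.mp hj))).symm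
  have hcomm : (N * x - x * N) * e = g * Z * g' * e := by
    ext i j
    rw [hmul, hmul]
    split_ifs with hj
    · exact hNZ i j hj
    · rfl
  refine ⟨g' * N * g * e, ?_, ?_, ?_⟩
  · refine (((isPar_of_upper hg'.1).mul hN).mul (isPar_of_upper hg.1)).mul ?_
    intro i j hij
    rw [he, Matrix.diagonal_apply_ne]
    rintro rfl
    exact lt_irrefl _ hij
  · have hsupp : g' * N * g * e = e * (g' * N * g * e) := by
      have : g' * N = e * (g' * N) := by
        calc g' * N = g' * e * N := by rw [Matrix.mul_assoc, hNe']
          _ = e * g' * e * N := by rw [hup g' hg'.1]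
          _ = e * (g' * (e * N)) := by noncomm_ring
          _ = _ := by rw [hNe']
      rw [Matrix.mul_assoc (g' * N), ← Matrix.mul_assoc e, ← this]
    rintro i j (hi | hj)
    · rw [hsupp, hmul', if_neg (not_lt.mpr hi)]
    · rw [hmul, if_neg (not_lt.mpr hj)]
  · intro i j hj
    have key : ((g' * N * g * e) * (g' * x * g) - (g' * x * g) * (g' * N * g * e)) * e = Z * e := by
      have hNx : (g' * N * g * e) * (g' * x * g) * e = g' * (N * x * (g * e)) := by
        calc (g' * N * g * e) * (g' * x * g) * e = g' * N * g * (e * (g' * x * g) * e) := by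
              noncomm_ring
          _ = g' * N * (g * g') * x * g * e := by rw [hup _ hy]; noncomm_ring
          _ = _ := by rw [h1]; noncomm_ring
      have hxN : (g' * x * g) * (g' * N * g * e) * e = g' * (x * N * (g * e)) := by
        calc (g' * x * g) * (g' * N * g * e) * e = g' * x * (g * g') * N * g * (e * e) := by
              noncomm_ring
          _ = _ := by rw [h1, hee]; noncomm_ring
      rw [Matrix.sub_mul, hNx, hxN, ← Matrix.mul_sub, ← Matrix.sub_mul, ← hup g hg.1]
      calc g' * ((N * x - x * N) * (e * g * e)) = g' * ((N * x - x * N) * e) * (g * e) := by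
            noncomm_ring
        _ = (g' * g) * Z * g' * (e * g * e) := by rw [hcomm]; noncomm_ring
        _ = (g' * g) * Z * (g' * g) * e := by rw [hup g hg.1]; noncomm_ring
        _ = Z * e := by rw [h2]; simp
    have := congrFun (congrFun key i) j
    rwa [hmul, hmul, if_pos hj, if_pos hj] at this

end Conditions

/-! ### Ranks of lower left corners. -/

section Corner

variable {n : ℕ} {F : Type*} [Field F] {c : Composition n}

/-- The submatrix of the rows from `i` on and the columns up to `m`, extended by zeros. -/
def corner (x : Matrix (Fin n) (Fin n) F) (i m : Fin n) : Matrix (Fin n) (Fin n) F :=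
  Matrix.of fun p j => if i ≤ p ∧ j ≤ m then x p j else 0

open Classical in
/-- The columns of the roots of the base in the rows from `i` on and the columns up to `m`. -/
noncomputable def cornerCols (c : Composition n) (i m : Fin n) : Finset (Fin n) :=
  Finset.univ.filter fun j => j ≤ m ∧ ∃ p, i ≤ p ∧ (p, j) ∈ base c

/-- The corners of `x` at the base have the ranks of the corners of the base. -/
def CornerRank (c : Composition n) (x : Matrix (Fin n) (Fin n) F) : Prop :=
  ∀ i m, (i, m) ∈ base c → (cornerCols c i m).card ≤ (corner x i m).rank

theorem corner_eq (x : Matrix (Fin n) (Fin n) F) (i m : Fin n) :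
    corner x i m = Matrix.diagonal (fun p => if i ≤ p then (1 : F) else 0) * x *
      Matrix.diagonal (fun j => if j ≤ m then (1 : F) else 0) := by
  ext p j
  rw [Matrix.mul_diagonal, Matrix.diagonal_mul, corner, Matrix.of_apply]
  by_cases hp : i ≤ p <;> by_cases hj : j ≤ m <;> simp [hp, hj]

/-- Upper triangular row operations add lower rows to higher ones and column operations add left
columns to right ones, so a lower left corner depends only on the same corner of the original
matrix. Its rank therefore cannot grow. -/
theorem corner_conj {g x h : Matrix (Fin n) (Fin n) F} (hg : ∀ i j, j < i → g i j = 0)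
    (hh : ∀ i j, j < i → h i j = 0) (i m : Fin n) :
    corner (g * x * h) i m =
      (Matrix.diagonal (fun p => if i ≤ p then (1 : F) else 0) * g) * corner x i m *
      (h * Matrix.diagonal (fun j => if j ≤ m then (1 : F) else 0)) := by
  have h1 : Matrix.diagonal (fun p => if i ≤ p then (1 : F) else 0) * g =
      Matrix.diagonal (fun p => if i ≤ p then (1 : F) else 0) * g *
        Matrix.diagonal (fun p => if i ≤ p then (1 : F) else 0) := by
    ext p q
    rw [Matrix.mul_diagonal, Matrix.diagonal_mul]
    by_cases hp : i ≤ p <;> by_cases hq : i ≤ q <;> simp only [hp, hq] <;> simp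
    exact hg _ _ ((not_le.mp hq).trans_le hp)
  have h2 : h * Matrix.diagonal (fun j => if j ≤ m then (1 : F) else 0) =
      Matrix.diagonal (fun j => if j ≤ m then (1 : F) else 0) *
        (h * Matrix.diagonal (fun j => if j ≤ m then (1 : F) else 0)) := by
    ext p q
    rw [Matrix.diagonal_mul, Matrix.mul_diagonal]
    by_cases hp : p ≤ m <;> by_cases hq : q ≤ m <;> simp only [hp, hq] <;> simp
    exact hh _ _ (hq.trans_lt (not_le.mp hp))
  rw [corner_eq, corner_eq x]
  calc _ = (Matrix.diagonal (fun p => if i ≤ p then (1 : F) else 0) * g) * x *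
        (h * Matrix.diagonal (fun j => if j ≤ m then (1 : F) else 0)) := by
        simp only [Matrix.mul_assoc]
    _ = _ := by
        conv_lhs => rw [h1, h2]
        simp only [Matrix.mul_assoc]

theorem UniConj.cornerRank {x y : Matrix (Fin n) (Fin n) F} (h : UniConj x y)
    (hx : CornerRank c x) : CornerRank c y := by
  obtain ⟨g, g', hg, hg', h1, h2, rfl⟩ := h
  intro i m him
  refine (hx i m him).trans ?_
  have hxy : x = g * (g' * x * g) * g' := by
    calc x = (g * g') * x * (g * g') := by rw [h1]; simp
      _ = _ := by noncomm_ring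
  conv_lhs => rw [hxy, corner_conj hg.1 hg'.1]
  exact (Matrix.rank_mul_le_left _ _).trans (Matrix.rank_mul_le_right _ _)

end Corner

/-! ### Tools for normalizing one column. -/

section Step

variable {n : ℕ} {F : Type*} [Field F] {c : Composition n}

/-- The columns of `x` less than `m` are supported on the extended base and nonzero at the base. -/
def NormalBelow (c : Composition n) (x : Matrix (Fin n) (Fin n) F) (m : ℕ) : Prop :=
  ∀ i j : Fin n, (j : ℕ) < m → ((i, j) ∉ extBase c → x i j = 0) ∧ ((i, j) ∈ base c → x i j ≠ 0)

/-- Column operations clear the rows of the roots of the base in the columns less than `m`. -/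
theorem exists_clear_rows {x : Matrix (Fin n) (Fin n) F} {m : Fin n} (hn : NormalBelow c x m)
    (v : Fin n → F) : ∃ w : Fin n → F, (∀ p, m ≤ p → w p = 0) ∧
      ∀ p l, (p, l) ∈ base c → l < m → (v + x.mulVec w) p = 0 := by
  have key : ∀ N : ℕ, ∃ w : Fin n → F, (∀ p, m ≤ p → w p = 0) ∧
      ∀ p l, (p, l) ∈ base c → l < m → n ≤ N + p → (v + x.mulVec w) p = 0 := by
    intro N
    induction N with
    | zero => exact ⟨0, by simp, fun p l _ _ h => by have := p.2; omega⟩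
    | succ N ih =>
      obtain ⟨w, hw, hwr⟩ := ih
      by_cases hp : ∃ p l, (p, l) ∈ base c ∧ l < m ∧ N + 1 + (p : ℕ) = n
      · obtain ⟨p, l, hpl, hl, hpN⟩ := hp
        have hx0 : x p l ≠ 0 := (hn p l hl).2 hpl
        -- Rows are cleared from the bottom up: column `l` vanishes below its base row `p`, so
        -- pivoting there leaves the rows already cleared untouched.
        refine ⟨w + Pi.single l (-(v + x.mulVec w) p / x p l), fun q hq => ?_,
          fun q k hqk hk hq => ?_⟩
        · rw [Pi.add_apply, hw q hq, Pi.single_eq_of_ne (hl.trans_le hq).ne', add_zero]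
        · rw [Matrix.mulVec_add, ← add_assoc, Pi.add_apply, Matrix.mulVec_single]
          simp only [Pi.smul_apply, MulOpposite.smul_eq_mul_unop, MulOpposite.unop_op,
            Matrix.col_apply]
          rcases eq_or_ne q p with rfl | hqp
          · field_simp
            ring
          · have hpq : p < q := by
              rw [Fin.lt_def]
              have : (q : ℕ) ≠ p := fun h => hqp (Fin.ext h)
              omega
            rw [hwr q k hqk hk (by rw [Fin.lt_def] at hpq; omega), (hn q l hl).1 ?_, zero_mul,
              add_zero]
            intro hql
            obtain ⟨k', hk', -, hkl, -⟩ := extBase_col hql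
            exact absurd (base_col_unique hkl hpl) (hpq.trans_le hk').ne'
      · refine ⟨w, hw, fun q k hqk hk hq => ?_⟩
        rcases eq_or_ne (N + 1 + (q : ℕ)) n with h | h
        · exact absurd ⟨q, k, hqk, hk, h⟩ hp
        · exact hwr q k hqk hk (by omega)
  obtain ⟨w, hw, h⟩ := key n
  exact ⟨w, hw, fun p l hpl hl => h p l hpl hl (by omega)⟩

/-- The functional that reads off the row `i` modulo the image of the columns less than `m`. -/
theorem exists_row_functional {x : Matrix (Fin n) (Fin n) F} {i m : Fin n}
    (hn : NormalBelow c x m) (him : (i, m) ∈ base c) :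
    ∃ ε : Fin n → F, ε i = 1 ∧ (∀ p, c.index p ≠ c.index i → ε p = 0) ∧ (∀ p < i, ε p = 0) ∧
      (∀ p, p ≠ i → (∀ l < m, (p, l) ∉ base c) → ε p = 0) ∧
      ∀ l < m, ∑ p, ε p * x p l = 0 := by
  have key : ∀ N : ℕ, ∃ ε : Fin n → F, ε i = 1 ∧ (∀ p, c.index p ≠ c.index i → ε p = 0) ∧
      (∀ p < i, ε p = 0) ∧ (∀ p, p ≠ i → (∀ l < m, (p, l) ∉ base c) → ε p = 0) ∧
      (∀ p, p ≠ i → N ≤ (p : ℕ) → ε p = 0) ∧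
      ∀ p l, (p, l) ∈ base c → (p : ℕ) < N → l < m → ∑ q, ε q * x q l = 0 := by
    intro N
    induction N with
    | zero => 
      refine ⟨Pi.single i 1, by simp, fun p hp => ?_, fun p hp => ?_, fun p hp _ => ?_,
        fun p hp _ => ?_, fun p l _ h => absurd h (by omega)⟩
      · exact Pi.single_eq_of_ne (fun h => hp (by rw [h])) _
      · exact Pi.single_eq_of_ne hp.ne _
      · exact Pi.single_eq_of_ne hp _
      · exact Pi.single_eq_of_ne hp _
    | succ N ih =>
      obtain ⟨ε, h1, h2, h3, h4, h5, h6⟩ := ih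
      by_cases hp : ∃ p l, (p, l) ∈ base c ∧ l < m ∧ (p : ℕ) = N ∧ c.index p = c.index i ∧ i < p
      · obtain ⟨p, l, hpl, hl, hpN, hβ, hip⟩ := hp
        have hx0 : x p l ≠ 0 := (hn p l hl).2 hpl
        -- Here rows are treated downwards. The new coefficient at `p` kills column `l`, and does
        -- not affect columns whose base row is above `p`, since these are zero in row `p`.
        refine ⟨ε + Pi.single p (-(∑ q, ε q * x q l) / x p l), ?_, fun q hq => ?_, fun q hq => ?_,
          fun q hq hqm => ?_, fun q hq hqN => ?_, fun q k hqk hqN hk => ?_⟩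
        · rw [Pi.add_apply, h1, Pi.single_eq_of_ne hip.ne, add_zero]
        · rw [Pi.add_apply, h2 q hq, Pi.single_eq_of_ne (fun h => hq (by rw [h, hβ])), add_zero]
        · rw [Pi.add_apply, h3 q hq, Pi.single_eq_of_ne (hq.trans hip).ne, add_zero]
        · rw [Pi.add_apply, h4 q hq hqm, Pi.single_eq_of_ne, add_zero]
          rintro rfl
          exact hqm l hl hpl
        · rw [Pi.add_apply, h5 q hq (by omega), Pi.single_eq_of_ne, add_zero]
          rintro rfl
          omega
        · simp only [Pi.add_apply, add_mul, Finset.sum_add_distrib, Pi.single_apply, ite_mul,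
            zero_mul, Finset.sum_ite_eq', Finset.mem_univ, if_true]
          rcases eq_or_ne q p with rfl | hqp
          · obtain rfl := base_row_unique hqk hpl
            field_simp
            ring
          · have hqp' : (q : ℕ) < p := by
              have : (q : ℕ) ≠ p := fun h => hqp (Fin.ext h)
              omega
            rw [h6 q k hqk (by omega) hk, (hn p k hk).1, mul_zero, add_zero]
            intro hpk
            obtain ⟨k', hk', -, hkl, -⟩ := extBase_col hpk
            rw [base_col_unique hkl hqk, Fin.le_def] at hk'
            omega
      · refine ⟨ε, h1, h2, h3, h4, fun q hq hqN => h5 q hq (by omega), fun q k hqk hqN hk => ?_⟩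
        by_cases hqN' : (q : ℕ) < N
        · exact h6 q k hqk hqN' hk
        · refine Finset.sum_eq_zero fun p _ => ?_
          by_cases hpk : (p, k) ∈ extBase c
          · obtain ⟨k', hk', hβ, hkl, -⟩ := extBase_col hpk
            obtain rfl := base_col_unique hkl hqk
            by_cases hβi : c.index p = c.index i
            · have : ¬ i < k' := fun h => hp ⟨k', k, hqk, hk, by omega, hβ.symm.trans hβi, h⟩
              rcases (not_lt.mp this).eq_or_lt with rfl | hlt
              · exact absurd (base_row_unique hqk him) hk.ne
              · rw [h3 p (hk'.trans_lt hlt), zero_mul]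
            · rw [h2 p hβi, zero_mul]
          · rw [(hn p k hk).1 hpk, mul_zero]
  obtain ⟨ε, h1, h2, h3, h4, -, h6⟩ := key n
  refine ⟨ε, h1, h2, h3, h4, fun l hl => ?_⟩
  by_cases hC : ∃ p, (p, l) ∈ base c
  · obtain ⟨p, hp⟩ := hC
    exact h6 p l hp p.2 hl
  · refine Finset.sum_eq_zero fun p _ => ?_
    rw [(hn p l hl).1, mul_zero]
    intro h
    obtain ⟨k, -, -, hk, -⟩ := extBase_col h
    exact hC ⟨k, hk⟩

/-- Conjugation by `1 + N` and an elementary column operation on the column `m`, where `N`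
commutes with the columns less than `m` of `x`. -/
theorem exists_uniConj_of_commute {x N : Matrix (Fin n) (Fin n) F} {m : Fin n} (hx : IsNil c x)
    (hN : ∀ i j, j ≤ i → N i j = 0) (hNm : ∀ i, N i m = 0)
    (hcomm : ∀ i j, j < m → (N * x) i j = (x * N) i j) {w : Fin n → F}
    (hw : ∀ p, m ≤ p → w p = 0) :
    ∃ y, UniConj x y ∧ (∀ i j, j < m → y i j = x i j) ∧
      ∀ i, y i m = ((1 + N).mulVec (x.col m) + x.mulVec w) i := by
  -- The conjugate is `(1 - W) k x k⁻¹ (1 + W)` with `W = w eₘᵀ`. On vectors supported before `m`,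
  -- `k` commutes with `x`, and `k` fixes `eₘ`; so columns before `m` are unchanged and column `m`
  -- becomes `k x eₘ + x w`. The left factor `1 - W` has no effect because the vectors it meets have
  -- zero entry at `m`.
  set k : Matrix (Fin n) (Fin n) F := 1 + N with hk
  have hkU : IsUnitri k := by
    refine ⟨fun i j hij => ?_, fun i => ?_⟩
    · rw [hk, Matrix.add_apply, Matrix.one_apply_ne hij.ne', hN _ _ hij.le, add_zero]
    · rw [hk, Matrix.add_apply, Matrix.one_apply_eq, hN _ _ le_rfl, add_zero]
  obtain ⟨k', hk'U, hkk', hk'k⟩ := hkU.exists_inv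
  set W : Matrix (Fin n) (Fin n) F := Matrix.vecMulVec w (Pi.single m 1) with hW
  have hWW : W * W = 0 := by
    rw [hW, Matrix.vecMulVec_mul_vecMulVec]
    simp [hw m le_rfl]
  have hWv : ∀ u : Fin n → F, W.mulVec u = u m • w := by
    intro u
    rw [hW, Matrix.vecMulVec_mulVec]
    ext i
    simp [mul_comm]
  have hW0 : ∀ i j, j ≤ i → W i j = 0 := by
    intro i j hij
    rw [hW, Matrix.vecMulVec_apply]
    rcases eq_or_ne j m with rfl | hj
    · rw [hw i hij, zero_mul]
    · rw [Pi.single_eq_of_ne hj, mul_zero]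
  have haU : IsUnitri (1 + W) := by
    refine ⟨fun i j hij => ?_, fun i => ?_⟩
    · rw [Matrix.add_apply, Matrix.one_apply_ne hij.ne', hW0 _ _ hij.le, add_zero]
    · rw [Matrix.add_apply, Matrix.one_apply_eq, hW0 _ _ le_rfl, add_zero]
  have haU' : IsUnitri (1 - W) := by
    refine ⟨fun i j hij => ?_, fun i => ?_⟩
    · rw [Matrix.sub_apply, Matrix.one_apply_ne hij.ne', hW0 _ _ hij.le, sub_zero]
    · rw [Matrix.sub_apply, Matrix.one_apply_eq, hW0 _ _ le_rfl, sub_zero]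
  have ha1 : (1 + W) * (1 - W) = 1 := by
    calc (1 + W) * (1 - W) = 1 - W * W := by noncomm_ring
      _ = 1 := by rw [hWW, sub_zero]
  have ha2 : (1 - W) * (1 + W) = 1 := by
    calc (1 - W) * (1 + W) = 1 - W * W := by noncomm_ring
      _ = 1 := by rw [hWW, sub_zero]
  have hcommv : ∀ u : Fin n → F, (∀ p, m ≤ p → u p = 0) →
      k.mulVec (x.mulVec u) = x.mulVec (k.mulVec u) := by
    intro u hu
    rw [Matrix.mulVec_mulVec, Matrix.mulVec_mulVec, hk, add_mul, mul_add, one_mul, mul_one,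
      Matrix.add_mulVec, Matrix.add_mulVec]
    congr 1
    ext i
    change ∑ j, (N * x) i j * u j = ∑ j, (x * N) i j * u j
    refine Finset.sum_congr rfl fun j _ => ?_
    rcases lt_or_ge j m with hj | hj
    · rw [hcomm i j hj]
    · rw [hu j hj, mul_zero, mul_zero]
  have hsupp : ∀ u : Fin n → F, (∀ p, m ≤ p → u p = 0) → ∀ p, m ≤ p → k'.mulVec u p = 0 := by
    intro u hu p hp
    change ∑ q, k' p q * u q = 0
    refine Finset.sum_eq_zero fun q _ => ?_
    rcases lt_or_ge q m with hq | hq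
    · rw [hk'U.1 _ _ (hq.trans_le hp), zero_mul]
    · rw [hu q hq, mul_zero]
  have hxm : ∀ u : Fin n → F, (∀ p, m ≤ p → u p = 0) → x.mulVec u m = 0 := by
    intro u hu
    change ∑ q, x m q * u q = 0
    refine Finset.sum_eq_zero fun q _ => ?_
    rcases lt_or_ge q m with hq | hq
    · rw [hx.upper _ _ hq, zero_mul]
    · rw [hu q hq, mul_zero]
  have hkxk : ∀ u : Fin n → F, (∀ p, m ≤ p → u p = 0) →
      k.mulVec (x.mulVec (k'.mulVec u)) = x.mulVec u := by
    intro u hu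
    rw [hcommv _ (hsupp u hu), Matrix.mulVec_mulVec _ k, hkk', Matrix.one_mulVec]
  have hk'm : k'.mulVec (Pi.single m 1) = Pi.single m 1 := by
    have : k.mulVec (Pi.single m 1) = Pi.single m 1 := by
      rw [hk, Matrix.add_mulVec, Matrix.one_mulVec, Matrix.mulVec_single_one]
      ext i
      simp [hNm i]
    calc k'.mulVec (Pi.single m 1) = k'.mulVec (k.mulVec (Pi.single m 1)) := by rw [this]
      _ = _ := by rw [Matrix.mulVec_mulVec, hk'k, Matrix.one_mulVec]
  have hfix : ∀ u : Fin n → F, u m = 0 → (1 - W).mulVec u = u := by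
    intro u hu
    rw [Matrix.sub_mulVec, Matrix.one_mulVec, hWv, hu, zero_smul, sub_zero]
  refine ⟨((1 - W) * k) * x * (k' * (1 + W)), ⟨k' * (1 + W), (1 - W) * k, hk'U.mul haU,
    haU'.mul hkU, ?_, ?_, rfl⟩, ?_, ?_⟩
  · rw [Matrix.mul_assoc, ← Matrix.mul_assoc (1 + W), ha1, Matrix.one_mul, hk'k]
  · rw [Matrix.mul_assoc, ← Matrix.mul_assoc k, hkk', Matrix.one_mul, ha2]
  · intro i j hj
    have hs : ∀ p, m ≤ p → (Pi.single j 1 : Fin n → F) p = 0 := fun p hp =>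
      Pi.single_eq_of_ne (hj.trans_le hp).ne' _
    have : (((1 - W) * k) * x * (k' * (1 + W))).mulVec (Pi.single j 1) =
        x.mulVec (Pi.single j 1) := by
      simp only [← Matrix.mulVec_mulVec, Matrix.add_mulVec 1 W, Matrix.one_mulVec, hWv]
      rw [hs m le_rfl, zero_smul, add_zero, hkxk _ hs, hfix _ (hxm _ hs)]
    simpa using congrFun this i
  · intro i
    have : (((1 - W) * k) * x * (k' * (1 + W))).mulVec (Pi.single m 1) =
        k.mulVec (x.col m) + x.mulVec w := by
      simp only [← Matrix.mulVec_mulVec, Matrix.add_mulVec 1 W, Matrix.one_mulVec, hWv]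
      rw [Pi.single_eq_same, one_smul, Matrix.mulVec_add, hk'm, Matrix.mulVec_add,
        Matrix.mulVec_add, hkxk w hw, Matrix.mulVec_single_one]
      refine hfix _ ?_
      rw [Pi.add_apply, hxm w hw, add_zero]
      have := ((isPar_of_upper hkU.1).mul_isNil hx) m m (lt_irrefl _)
      rwa [Matrix.mul_apply] at this
    simpa using congrFun this i

end Step

/-! ### Existence of the normal form. -/

section Reduction

variable {n : ℕ} {F : Type*} [Field F] {c : Composition n}

/-- The rank of the corner forces the entry at the base to be nonzero. -/
theorem CornerRank.ne_zero {x : Matrix (Fin n) (Fin n) F} {i m : Fin n} (hx : CornerRank c x)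
    (hn : NormalBelow c x m) (him : (i, m) ∈ base c) {w : Fin n → F} (hw : ∀ p, m ≤ p → w p = 0)
    (hv : ∀ p, i < p → (x.col m + x.mulVec w) p = 0) : (x.col m + x.mulVec w) i ≠ 0 := by
  intro h0
  have hv' : ∀ p, i ≤ p → x p m = - ∑ q, x p q * w q := by
    intro p hp
    rcases hp.eq_or_lt with rfl | hp
    · exact eq_neg_of_add_eq_zero_left h0
    · exact eq_neg_of_add_eq_zero_left (hv p hp)
  have hmT : m ∈ cornerCols c i m := by
    simp only [cornerCols, Finset.mem_filter, Finset.mem_univ, true_and]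
    exact ⟨le_rfl, i, le_rfl, him⟩
  have hzero : ∀ p q, i ≤ p → q < m → q ∉ cornerCols c i m → x p q = 0 := by
    intro p q hp hq hqT
    refine (hn p q hq).1 fun hpq => hqT ?_
    obtain ⟨k, hk, -, hkq, -⟩ := extBase_col hpq
    simp only [cornerCols, Finset.mem_filter, Finset.mem_univ, true_and]
    exact ⟨hq.le, k, hp.trans hk, hkq⟩
  set T := (cornerCols c i m).erase m with hT
  set d : Fin n → F := fun j => if j ∈ T then 1 else 0 with hd
  -- If the pivot vanished, column `m` of the corner would be a combination of earlier columns, and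
  -- among those only base columns are nonzero. The corner thus factors through the columns in `T`,
  -- one fewer than `CornerRank` requires.
  have hK : corner x i m = corner x i m * Matrix.diagonal d *
      (1 - Matrix.vecMulVec w (Pi.single m 1)) := by
    ext p j
    rw [Matrix.mul_sub, Matrix.mul_one, Matrix.sub_apply, Matrix.mul_diagonal, Matrix.mul_apply]
    simp only [Matrix.mul_diagonal, Matrix.vecMulVec_apply, corner, Matrix.of_apply, hd]
    by_cases hp : i ≤ p
    · simp only [hp, true_and]
      rcases lt_trichotomy j m with hj | rfl | hj
      · simp only [hj.le, if_true, Pi.single_eq_of_ne hj.ne, mul_zero, Finset.sum_const_zero,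
          sub_zero]
        by_cases hjT : j ∈ T
        · simp [hjT]
        · rw [if_neg hjT, mul_zero]
          exact hzero p j hp hj fun h => hjT (Finset.mem_erase.mpr ⟨hj.ne, h⟩)
      · have hjT : j ∉ T := Finset.notMem_erase _ _
        simp only [le_refl, if_true, hjT, if_false, mul_zero, Pi.single_eq_same, mul_one, zero_sub]
        rw [hv' p hp]
        congr 1
        refine Finset.sum_congr rfl fun q _ => ?_
        rcases lt_or_ge q j with hq | hq
        · by_cases hqT : q ∈ T
          · simp [hqT, hq.le]
          · rw [hzero p q hp hq fun h => hqT (Finset.mem_erase.mpr ⟨hq.ne, h⟩)]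
            simp
        · rw [hw q hq, mul_zero, mul_zero]
      · have hj' : ¬ j ≤ m := not_le.mpr hj
        simp [hj', Pi.single_eq_of_ne hj.ne']
    · simp [hp]
  have hrank : (corner x i m).rank ≤ T.card := by
    classical
    rw [hK]
    refine (Matrix.rank_mul_le_left _ _).trans ((Matrix.rank_mul_le_right _ _).trans ?_)
    rw [Matrix.rank_diagonal, Fintype.card_subtype]
    refine Finset.card_le_card fun j hj => ?_
    by_contra hjT
    simp [hd, hjT] at hj
  have hcard := Finset.card_erase_lt_of_mem hmT
  have := hx i m him
  rw [← hT] at hcard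
  omega

/-- The column `m` is brought to the normal form. -/
theorem exists_normal_succ {x : Matrix (Fin n) (Fin n) F} (m : Fin n) (hx : IsNil c x)
    (hR : Rich c x m) (hC : CornerRank c x) (hn : NormalBelow c x m) :
    ∃ y, UniConj x y ∧ NormalBelow c y (m + 1) := by
  have hfinish : ∀ y : Matrix (Fin n) (Fin n) F, (∀ i j, j < m → y i j = x i j) →
      (∀ i, ((i, m) ∉ extBase c → y i m = 0) ∧ ((i, m) ∈ base c → y i m ≠ 0)) →
      NormalBelow c y (m + 1) := by
    intro y hy hym i j hj
    rcases (Nat.lt_succ_iff.mp hj).lt_or_eq with hj | hj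
    · rw [hy i j hj]
      exact hn i j hj
    · rw [Fin.ext hj]
      exact hym i
  obtain ⟨w0, hw0, hv0⟩ := exists_clear_rows hn (x.col m)
  set v := x.col m + x.mulVec w0 with hv
  have hvβ : ∀ p, ¬ c.index p < c.index m → v p = 0 := by
    intro p hp
    have h2 : x.mulVec w0 p = 0 := by
      change ∑ q, x p q * w0 q = 0
      refine Finset.sum_eq_zero fun q _ => ?_
      rcases lt_or_ge q m with hq | hq
      · rw [hx _ _ fun h => hp (h.trans_le (index_mono c hq.le)), zero_mul]
      · rw [hw0 q hq, mul_zero]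
    rw [hv, Pi.add_apply, h2, Matrix.col_apply, hx _ _ hp, add_zero]
  by_cases hi : ∃ i, (i, m) ∈ base c
  · obtain ⟨i, him⟩ := hi
    have hβim := base_index_lt him
    have hv_gt : ∀ p, i < p → v p = 0 := by
      intro p hp
      by_cases hβ : c.index p < c.index m
      · rcases base_cases hβ with h | ⟨l, hl, h⟩ | ⟨k, hk, h⟩
        · exact absurd (base_col_unique him h) hp.ne
        · exact hv0 p l h hl
        · exact absurd (base_col_unique him h) (hp.trans hk).ne
      · exact hvβ p hβ
    have hvi : v i ≠ 0 := hC.ne_zero hn him hw0 hv_gt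
    obtain ⟨ε, hε1, hεβ, hεlt, hεu, hεx⟩ := exists_row_functional hn him
    have hεv : ∑ p, ε p * v p = v i := by
      rw [Finset.sum_eq_single i (fun p _ hp => ?_) (by simp), hε1, one_mul]
      by_cases hβ : c.index p = c.index i
      · by_cases hl : ∃ l < m, (p, l) ∈ base c
        · obtain ⟨l, hl, h⟩ := hl
          rw [hv0 p l h hl, mul_zero]
        · rw [hεu p hp fun l hl' h => hl ⟨l, hl', h⟩, zero_mul]
      · rw [hεβ p hβ, zero_mul]
    have hεm : ∀ p, m ≤ p → ε p = 0 := fun p hp =>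
      hεβ p (hβim.trans_le (index_mono c hp)).ne'
    classical
    -- The entries above the pivot to be removed: `z1` in earlier block rows, `z2` in the block row
    -- of `i` outside the extended base. Since `ε` kills the columns before `m`, `z εᵀ x` vanishes
    -- there for every `z`. Also `x z2 = 0`, and the defect `-x z1 εᵀ` is cancelled by adding `x M`
    -- with `[M, x] = z1 εᵀ`; thus `N` commutes with `x` on those columns.
    set z1 : Fin n → F := fun p => if c.index p < c.index i then -(v p) / v i else 0 with hz1
    set z2 : Fin n → F := fun p =>
      if p < i ∧ c.index p = c.index i ∧ (p, m) ∉ extBase c then -(v p) / v i else 0 with hz2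
    obtain ⟨M, hMp, hM0, hMZ⟩ := hR (Matrix.vecMulVec z1 ε) (by
      intro p q hpq
      rw [Matrix.vecMulVec_apply]
      by_cases hq : c.index q = c.index i
      · rw [hz1]
        simp only
        rw [if_neg (hq ▸ hpq), zero_mul]
      · rw [hεβ q hq, mul_zero])
    set N := Matrix.vecMulVec (z1 + z2) ε + x * M with hN
    have hxz2 : x.mulVec z2 = 0 := by
      ext p
      change ∑ q, x p q * z2 q = 0
      refine Finset.sum_eq_zero fun q _ => ?_
      by_cases hq : q < i ∧ c.index q = c.index i ∧ (q, m) ∉ extBase c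
      · rw [(hn p q (hq.1.trans (base_lt him))).1, zero_mul]
        intro hpq
        obtain ⟨k, -, -, hk, -⟩ := extBase_col hpq
        -- A base root in column `q` together with `(i, m)` would put `(q, m)` in `Φ`; so column `q`
        -- of `x` is zero.
        exact hq.2.2 (Or.inr (mem_phi_iff.mpr ⟨⟨k, hk⟩, i, hq.1, hq.2.1, him⟩))
      · simp only [hz2, if_neg hq, mul_zero]
    have hN0 : ∀ p q, q ≤ p → N p q = 0 := by
      intro p q hqp
      have h1 : (x * M) p q = 0 := (hx.mul_isPar hMp) _ _ (not_lt.mpr (index_mono c hqp))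
      rw [hN, Matrix.add_apply, h1, add_zero, Matrix.vecMulVec_apply]
      by_cases hq : c.index q = c.index i
      · by_cases hqi : q < i
        · rw [hεlt q hqi, mul_zero]
        · have hip : i ≤ p := (not_lt.mp hqi).trans hqp
          have e1 : z1 p = 0 := if_neg (not_lt.mpr (index_mono c hip))
          have e2 : z2 p = 0 := if_neg fun h => absurd h.1 (not_lt.mpr hip)
          rw [Pi.add_apply, e1, e2, add_zero, zero_mul]
      · rw [hεβ q hq, mul_zero]
    have hNm : ∀ p, N p m = 0 := by
      intro p
      rw [hN, Matrix.add_apply, Matrix.vecMulVec_apply, hεm m le_rfl, mul_zero, zero_add,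
        Matrix.mul_apply]
      exact Finset.sum_eq_zero fun q _ => by rw [hM0 q m (Or.inr le_rfl), mul_zero]
    have hcomm : ∀ p j, j < m → (N * x) p j = (x * N) p j := by
      intro p j hj
      have hA : ∀ z : Fin n → F, (Matrix.vecMulVec z ε * x) p j = 0 := by
        intro z
        rw [Matrix.mul_apply]
        simp only [Matrix.vecMulVec_apply, mul_assoc]
        rw [← Finset.mul_sum, hεx j hj, mul_zero]
      have hB : x * Matrix.vecMulVec z2 ε = 0 := by
        rw [Matrix.mul_vecMulVec, hxz2, Matrix.zero_vecMulVec]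
      have hC' : (x * (M * x - x * M)) p j = (x * Matrix.vecMulVec z1 ε) p j := by
        rw [Matrix.mul_apply, Matrix.mul_apply]
        exact Finset.sum_congr rfl fun q _ => by rw [hMZ q j hj]
      have hD : N * x - x * N = Matrix.vecMulVec (z1 + z2) ε * x + x * (M * x - x * M) -
          x * Matrix.vecMulVec z1 ε := by
        have : x * Matrix.vecMulVec (z1 + z2) ε = x * Matrix.vecMulVec z1 ε := by
          rw [Matrix.add_vecMulVec, mul_add, hB, add_zero]
        rw [hN, mul_add, this]
        noncomm_ring
      have := congrFun (congrFun hD p) j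
      rw [Matrix.sub_apply, Matrix.sub_apply, Matrix.add_apply, hA, hC', zero_add, sub_self] at this
      exact sub_eq_zero.mp this
    -- The first term of `w` carries the row clearing by `w0` through `1 + N`; the second cancels
    -- the contribution `x M v` of the correction in `N`. Column `m` becomes `v + v i • (z1 + z2)`.
    obtain ⟨y, hxy, hy, hym⟩ := exists_uniConj_of_commute hx hN0 hNm hcomm
      (w := (1 + N).mulVec w0 - M.mulVec v) (by
        intro p hp
        have h1 : (1 + N).mulVec w0 p = 0 := by
          change ∑ q, (1 + N) p q * w0 q = 0
          refine Finset.sum_eq_zero fun q _ => ?_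
          rcases lt_or_ge q m with hq | hq
          · rw [Matrix.add_apply, Matrix.one_apply_ne (hq.trans_le hp).ne',
              hN0 _ _ (hq.trans_le hp).le, add_zero, zero_mul]
          · rw [hw0 q hq, mul_zero]
        have h2 : M.mulVec v p = 0 := by
          change ∑ q, M p q * v q = 0
          exact Finset.sum_eq_zero fun q _ => by rw [hM0 p q (Or.inl hp), zero_mul]
        rw [Pi.sub_apply, h1, h2, sub_zero])
    refine ⟨y, hxy, hfinish y hy ?_⟩
    have hcol : (1 + N).mulVec (x.col m) + x.mulVec ((1 + N).mulVec w0 - M.mulVec v) =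
        v + v i • (z1 + z2) := by
      have h1 : x.mulVec ((1 + N).mulVec w0) = (1 + N).mulVec (x.mulVec w0) := by
        rw [Matrix.mulVec_mulVec, Matrix.mulVec_mulVec, mul_add, add_mul, mul_one, one_mul,
          Matrix.add_mulVec, Matrix.add_mulVec]
        congr 1
        ext p
        change ∑ j, (x * N) p j * w0 j = ∑ j, (N * x) p j * w0 j
        refine Finset.sum_congr rfl fun j _ => ?_
        rcases lt_or_ge j m with hj | hj
        · rw [hcomm p j hj]
        · rw [hw0 j hj, mul_zero, mul_zero]
      have h2 : (Matrix.vecMulVec (z1 + z2) ε).mulVec v = v i • (z1 + z2) := by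
        rw [Matrix.vecMulVec_mulVec]
        change MulOpposite.op (∑ p, ε p * v p) • (z1 + z2) = _
        rw [hεv]
        ext p
        simp [mul_comm, mul_add]
      rw [Matrix.mulVec_sub, h1, add_sub_assoc', ← Matrix.mulVec_add, ← hv, Matrix.add_mulVec,
        Matrix.one_mulVec, hN, Matrix.add_mulVec, h2, ← Matrix.mulVec_mulVec]
      abel
    intro p
    rw [hym p, hcol, Pi.add_apply, Pi.smul_apply, Pi.add_apply, smul_eq_mul]
    rcases lt_trichotomy p i with hp | rfl | hp
    · refine ⟨fun hpm => ?_, fun h => absurd (base_col_unique him h) hp.ne'⟩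
      rcases (index_mono c hp.le).lt_or_eq with hβ | hβ
      · have e1 : z1 p = -(v p) / v i := if_pos hβ
        have e2 : z2 p = 0 := if_neg fun h => hβ.ne h.2.1
        rw [e1, e2]
        field_simp
        ring
      · have e1 : z1 p = 0 := if_neg hβ.not_lt
        have e2 : z2 p = -(v p) / v i := if_pos ⟨hp, hβ, hpm⟩
        rw [e1, e2]
        field_simp
        ring
    · have e1 : z1 p = 0 := if_neg (lt_irrefl _)
      have e2 : z2 p = 0 := if_neg fun h => lt_irrefl _ h.1
      rw [e1, e2, add_zero, mul_zero, add_zero]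
      exact ⟨fun h => absurd (Or.inl him) h, fun _ => hvi⟩
    · have e1 : z1 p = 0 := if_neg (not_lt.mpr (index_mono c hp.le))
      have e2 : z2 p = 0 := if_neg fun h => lt_asymm hp h.1
      rw [e1, e2, add_zero, mul_zero, add_zero, hv_gt p hp]
      exact ⟨fun _ => rfl, fun h => absurd (base_col_unique him h) hp.ne⟩
  · obtain ⟨y, hxy, hy, hym⟩ := exists_uniConj_of_commute (N := 0) hx (by simp) (by simp)
      (by simp) hw0
    refine ⟨y, hxy, hfinish y hy fun p => ⟨fun _ => ?_, fun h => absurd ⟨p, h⟩ hi⟩⟩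
    rw [hym p, add_zero, Matrix.one_mulVec]
    by_cases hβ : c.index p < c.index m
    · rcases base_cases hβ with h | ⟨l, hl, h⟩ | ⟨k, hk, h⟩
      · exact absurd ⟨p, h⟩ hi
      · exact hv0 p l h hl
      · exact absurd ⟨k, h⟩ hi
    · exact hvβ p hβ

/-- Every matrix of the nilradical in general position is conjugate under the unitriangular group
to a matrix supported on the extended base and nonzero at the base. -/
theorem exists_uniConj_extSupported {x : Matrix (Fin n) (Fin n) F} (hx : IsNil c x)
    (hR : ∀ m, Rich c x m) (hC : CornerRank c x) :
    ∃ y, UniConj x y ∧ ExtSupported c y ∧ BaseNonzero c y := by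
  have key : ∀ k ≤ n, ∃ y, UniConj x y ∧ NormalBelow c y k := by
    intro k
    induction k with
    | zero => exact fun _ => ⟨x, .refl x, fun i j h => absurd h (Nat.not_lt_zero _)⟩
    | succ k ih =>
      intro hk
      obtain ⟨y, hxy, hy⟩ := ih (by omega)
      obtain ⟨z, hyz, hz⟩ := exists_normal_succ ⟨k, hk⟩ (hxy.isNil hx) (hxy.rich hx (hR _))
        (hxy.cornerRank hC) hy
      exact ⟨z, hxy.trans hyz, hz⟩
  obtain ⟨y, hxy, hy⟩ := key n le_rfl
  exact ⟨y, hxy, fun i j h => (hy i j j.2).1 h, fun i j h => (hy i j j.2).2 h⟩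

end Reduction

/-! ### Positions in blocks and the nearest sufficiently large block. -/

section Blocks

variable {n : ℕ}

/-- The size of the `b`-th block, zero if there is none. -/
def blockSize (c : Composition n) (b : ℕ) : ℕ := c.sizeUpTo (b + 1) - c.sizeUpTo b

/-- The position of an index in its block. -/
def pos (c : Composition n) (i : Fin n) : ℕ := i - c.sizeUpTo (c.index i)

/-- The number of the block of an index. -/
def blk (c : Composition n) (i : Fin n) : ℕ := c.index i

variable {c : Composition n}

theorem val_eq (i : Fin n) : (i : ℕ) = c.sizeUpTo (blk c i) + pos c i := by
  have := c.sizeUpTo_index_le i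
  unfold pos blk
  omega

theorem pos_lt (i : Fin n) : pos c i < blockSize c (blk c i) := by
  have h1 := c.sizeUpTo_index_le i
  have h2 := c.lt_sizeUpTo_index_succ i
  unfold pos blk blockSize
  simp only [Fin.val_succ] at h2
  omega

theorem index_eq_iff {i j : Fin n} : c.index i = c.index j ↔ blk c i = blk c j := Fin.ext_iff

theorem blk_mono {i j : Fin n} (h : i ≤ j) : blk c i ≤ blk c j := index_mono c h

theorem eq_of_blk_pos {i j : Fin n} (h1 : blk c i = blk c j) (h2 : pos c i = pos c j) : i = j := by
  apply Fin.ext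
  rw [val_eq (c := c) i, val_eq (c := c) j, h1, h2]

theorem lt_of_blk {i j : Fin n} (h : blk c i < blk c j) : i < j := index_lt_iff_lt h

theorem lt_of_pos {i j : Fin n} (h : blk c i = blk c j) (h2 : pos c i < pos c j) : i < j := by
  rw [Fin.lt_def, val_eq (c := c) i, val_eq (c := c) j, h]
  omega

theorem pos_lt_of_lt {i j : Fin n} (h : blk c i = blk c j) (h2 : i < j) : pos c i < pos c j := by
  rw [Fin.lt_def, val_eq (c := c) i, val_eq (c := c) j, h] at h2
  omega

theorem exists_blk_pos {b k : ℕ} (h : k < blockSize c b) : ∃ i, blk c i = b ∧ pos c i = k := by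
  unfold blockSize at h
  have hle : c.sizeUpTo (b + 1) ≤ n := c.sizeUpTo_le _
  have hi : c.sizeUpTo b + k < n := by omega
  let i : Fin n := ⟨c.sizeUpTo b + k, hi⟩
  have h1 := c.sizeUpTo_index_le i
  have h2 := c.lt_sizeUpTo_index_succ i
  simp only [Fin.val_succ] at h2
  have hival : (i : ℕ) = c.sizeUpTo b + k := rfl
  have hb : blk c i = b := by
    unfold blk
    rcases lt_trichotomy (c.index i : ℕ) b with hlt | heq | hlt
    · have := c.monotone_sizeUpTo (Nat.succ_le_of_lt hlt)
      simp only [Nat.succ_eq_add_one] at this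
      omega
    · exact heq
    · have := c.monotone_sizeUpTo (Nat.succ_le_of_lt hlt)
      simp only [Nat.succ_eq_add_one] at this
      omega
  refine ⟨i, hb, ?_⟩
  have := val_eq (c := c) i
  rw [hb] at this
  omega

theorem blockSize_pos {b : ℕ} : 0 < blockSize c b ↔ b < c.length := by
  constructor
  · intro h
    obtain ⟨i, rfl, -⟩ := exists_blk_pos h
    exact (c.index i).2
  · intro h
    have := c.sizeUpTo_strict_mono h
    unfold blockSize
    omega

theorem blk_lt_length (i : Fin n) : blk c i < c.length := (c.index i).2

theorem blockSize_eq (t : Fin c.length) : blockSize c t = c.blocksFun t := by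
  have := c.sizeUpTo_succ' t
  unfold blockSize
  omega

/-- The block `b` is the last one before the block `s` that has more than `k` indices. -/
def IsPred (c : Composition n) (b s k : ℕ) : Prop :=
  b < s ∧ k < blockSize c b ∧ ∀ b', b < b' → b' < s → blockSize c b' ≤ k

theorem IsPred.unique {b b' s k : ℕ} (h : IsPred c b s k) (h' : IsPred c b' s k) : b = b' := by
  rcases lt_trichotomy b b' with hlt | rfl | hlt
  · have := h.2.2 b' hlt h'.1
    have := h'.2.1
    omega
  · rfl
  · have := h'.2.2 b hlt h.1
    have := h.2.1
    omega

theorem IsPred.unique_right {b s s' k : ℕ} (h : IsPred c b s k) (h' : IsPred c b s' k)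
    (hs : k < blockSize c s) (hs' : k < blockSize c s') : s = s' := by
  rcases lt_trichotomy s s' with hlt | rfl | hlt
  · have := h'.2.2 s h.1 hlt
    omega
  · rfl
  · have := h.2.2 s' h'.1 hlt
    omega

theorem exists_isPred {a s k : ℕ} (h : a < s) (hk : k < blockSize c a) :
    ∃ b, a ≤ b ∧ IsPred c b s k := by
  classical
  have hne : ∃ d, k < blockSize c (s - 1 - d) ∧ a ≤ s - 1 - d :=
    ⟨s - 1 - a, by rwa [show s - 1 - (s - 1 - a) = a by omega], by omega⟩
  have hspec := Nat.find_spec hne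
  refine ⟨s - 1 - Nat.find hne, hspec.2, by omega, hspec.1, fun b' h1 h2 => ?_⟩
  have hmin := Nat.find_min hne (m := s - 1 - b') (by omega)
  rw [show s - 1 - (s - 1 - b') = b' by omega] at hmin
  by_contra hlt
  exact hmin ⟨not_le.mp hlt, by omega⟩

theorem exists_isPred_right {b a k : ℕ} (h : b < a) (hb : k < blockSize c b)
    (hk : k < blockSize c a) : ∃ s, s ≤ a ∧ IsPred c b s k ∧ k < blockSize c s := by
  classical
  have hne : ∃ s, b < s ∧ k < blockSize c s := ⟨a, h, hk⟩
  refine ⟨Nat.find hne, Nat.find_min' hne ⟨h, hk⟩, ⟨(Nat.find_spec hne).1, hb, fun b' h1 h2 => ?_⟩,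
    (Nat.find_spec hne).2⟩
  by_contra hlt
  exact Nat.find_min hne h2 ⟨h1, not_le.mp hlt⟩

end Blocks

/-! ### The line diagram and surjectivity of its adjoint map. -/

section Line

variable {n : ℕ} {c : Composition n}

/-- The index `i` precedes `j` on a line through the indices with the same position. -/
def Prev (c : Composition n) (i j : Fin n) : Prop :=
  pos c i = pos c j ∧ IsPred c (blk c i) (blk c j) (pos c j)

theorem Prev.left_unique {i i' j : Fin n} (h : Prev c i j) (h' : Prev c i' j) : i = i' :=
  eq_of_blk_pos (h.2.unique h'.2) (h.1.trans h'.1.symm)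

theorem Prev.right_unique {i j j' : Fin n} (h : Prev c i j) (h' : Prev c i j') : j = j' := by
  have hp : pos c j = pos c j' := h.1.symm.trans h'.1
  refine eq_of_blk_pos (h.2.unique_right (hp ▸ h'.2) (pos_lt j) ?_) hp
  rw [hp]
  exact pos_lt j'

theorem Prev.blk_lt {i j : Fin n} (h : Prev c i j) : blk c i < blk c j := h.2.1

theorem exists_prev_right {i j : Fin n} (h : blk c i < blk c j) (hp : pos c i ≤ pos c j) :
    ∃ s, Prev c i s ∧ blk c s ≤ blk c j := by
  obtain ⟨s, hs, hpred, hk⟩ := exists_isPred_right h (pos_lt i) (hp.trans_lt (pos_lt j))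
  obtain ⟨t, rfl, ht⟩ := exists_blk_pos hk
  exact ⟨t, ⟨ht.symm, ht ▸ hpred⟩, hs⟩

theorem exists_prev_left {i j : Fin n} (h : blk c i < blk c j) (hp : pos c j ≤ pos c i) :
    ∃ d, Prev c d j ∧ blk c i ≤ blk c d := by
  obtain ⟨b, hb, hpred⟩ := exists_isPred h (hp.trans_lt (pos_lt i))
  obtain ⟨t, rfl, ht⟩ := exists_blk_pos hpred.2.1
  exact ⟨t, ⟨ht, hpred⟩, hb⟩

variable {F : Type*} [Field F]

open Classical in
/-- The matrix of the line diagram. -/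
noncomputable def lineMatrix (F : Type*) [Field F] (c : Composition n) :
    Matrix (Fin n) (Fin n) F := Matrix.of fun i j => if Prev c i j then 1 else 0

theorem lineMatrix_isNil : IsNil c (lineMatrix F c) := fun i j h => by
  rw [lineMatrix, Matrix.of_apply, if_neg fun h' => h h'.blk_lt]

/-- The conditions on `N` in the definition of `Rich`. -/
def SolvesAd (c : Composition n) (x : Matrix (Fin n) (Fin n) F) (m : Fin n)
    (N Z : Matrix (Fin n) (Fin n) F) : Prop :=
  IsPar c N ∧ (∀ i j, m ≤ i ∨ m ≤ j → N i j = 0) ∧ ∀ i j, j < m → (N * x - x * N) i j = Z i j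

theorem SolvesAd.add {x N Z N' Z' : Matrix (Fin n) (Fin n) F} {m : Fin n}
    (h : SolvesAd c x m N Z) (h' : SolvesAd c x m N' Z') : SolvesAd c x m (N + N') (Z + Z') := by
  refine ⟨fun i j hij => ?_, fun i j hij => ?_, fun i j hj => ?_⟩
  · rw [Matrix.add_apply, h.1 i j hij, h'.1 i j hij, add_zero]
  · rw [Matrix.add_apply, h.2.1 i j hij, h'.2.1 i j hij, add_zero]
  · have : (N + N') * x - x * (N + N') = (N * x - x * N) + (N' * x - x * N') := by
      rw [add_mul, mul_add]
      abel
    rw [this, Matrix.add_apply, Matrix.add_apply, h.2.2 i j hj, h'.2.2 i j hj]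

theorem SolvesAd.congr {x N Z Z' : Matrix (Fin n) (Fin n) F} {m : Fin n}
    (h : SolvesAd c x m N Z) (h' : ∀ i j, j < m → Z i j = Z' i j) : SolvesAd c x m N Z' :=
  ⟨h.1, h.2.1, fun i j hj => (h.2.2 i j hj).trans (h' i j hj)⟩

theorem solvesAd_single {x : Matrix (Fin n) (Fin n) F} {m p q : Fin n} (hpq : blk c p ≤ blk c q)
    (hp : p < m) (hq : q < m) (t : F) :
    SolvesAd c x m (Matrix.single p q t)
      (Matrix.single p q t * x - x * Matrix.single p q t) := by
  refine ⟨fun i j hij => ?_, fun i j hij => ?_, fun _ _ _ => rfl⟩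
  · refine Matrix.single_apply_of_ne _ _ _ _ _ ?_
    rintro ⟨rfl, rfl⟩
    exact absurd hij (not_lt.mpr hpq)
  · refine Matrix.single_apply_of_ne _ _ _ _ _ ?_
    rintro ⟨rfl, rfl⟩
    rcases hij with h | h
    · exact absurd hp (not_lt.mpr h)
    · exact absurd hq (not_lt.mpr h)

theorem single_comm_lineMatrix (p q : Fin n) (t : F) (i j : Fin n) [Decidable (i = p ∧ Prev c q j)]
    [Decidable (Prev c i p ∧ j = q)] :
    (Matrix.single p q t * lineMatrix F c - lineMatrix F c * Matrix.single p q t) i j =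
      (if i = p ∧ Prev c q j then t else 0) - if Prev c i p ∧ j = q then t else 0 := by
  rw [Matrix.sub_apply]
  congr 1
  · by_cases hi : i = p
    · subst hi
      rw [Matrix.single_mul_apply_same, lineMatrix, Matrix.of_apply]
      by_cases h : Prev c q j <;> simp [h]
    · rw [Matrix.single_mul_apply_of_ne _ _ _ _ _ hi, if_neg fun h => hi h.1]
  · by_cases hj : j = q
    · subst hj
      rw [Matrix.mul_single_apply_same, lineMatrix, Matrix.of_apply]
      by_cases h : Prev c i p <;> simp [h]
    · rw [Matrix.mul_single_apply_of_ne _ _ _ _ _ hj, if_neg fun h => hj h.2]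

/-- With `s` the successor of `a` on its line, `-E_{sj}` has commutator `E_{aj} - E_{sl}`, where `l`
is the successor of `j`. The error moves to the right, and is absent or falls outside the columns
before `m` once the line of `j` gives no such `l`. -/
theorem exists_solvesAd_of_pos_le (m : Fin n) (k : ℕ) :
    ∀ a j : Fin n, n ≤ k + j → blk c a < blk c j → pos c a ≤ pos c j → j < m →
      ∃ N, SolvesAd c (lineMatrix F c) m N (Matrix.single a j 1) := by
  classical
  induction k with
  | zero => intro a j h; have := j.2; omega
  | succ k ih =>
    intro a j hk hβ hp hj
    obtain ⟨s, hs, hsβ⟩ := exists_prev_right hβ hp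
    have hsj : s ≤ j := by
      rcases hsβ.lt_or_eq with h | h
      · exact (lt_of_blk h).le
      · rcases (hs.1 ▸ hp).lt_or_eq with h' | h'
        · exact (lt_of_pos h h').le
        · exact (eq_of_blk_pos h h').le
    have h1 := solvesAd_single (c := c) (x := lineMatrix F c) hsβ (hsj.trans_lt hj) hj (-1)
    by_cases hnext : ∃ l, Prev c j l ∧ l < m
    · obtain ⟨l, hl, hlm⟩ := hnext
      obtain ⟨N, hN⟩ := ih s l (by have := lt_of_blk hl.blk_lt; rw [Fin.lt_def] at this; omega)
        (hsβ.trans_lt hl.blk_lt) (by rw [← hs.1, ← hl.1]; exact hp) hlm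
      refine ⟨_, (h1.add hN).congr fun i q hq => ?_⟩
      rw [Matrix.add_apply, single_comm_lineMatrix, Matrix.single_apply, Matrix.single_apply]
      have e1 : (i = s ∧ Prev c j q) ↔ (s = i ∧ l = q) :=
        ⟨fun h => ⟨h.1.symm, hl.right_unique h.2⟩, fun h => ⟨h.1.symm, h.2 ▸ hl⟩⟩
      have e2 : (Prev c i s ∧ q = j) ↔ (a = i ∧ j = q) :=
        ⟨fun h => ⟨hs.left_unique h.1, h.2.symm⟩, fun h => ⟨h.1 ▸ hs, h.2.symm⟩⟩
      simp only [e1, e2]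
      split_ifs <;> simp
    · refine ⟨_, h1.congr fun i q hq => ?_⟩
      rw [single_comm_lineMatrix, Matrix.single_apply]
      have e1 : ¬ (i = s ∧ Prev c j q) := fun h => hnext ⟨q, h.2, hq⟩
      have e2 : (Prev c i s ∧ q = j) ↔ (a = i ∧ j = q) :=
        ⟨fun h => ⟨hs.left_unique h.1, h.2.symm⟩, fun h => ⟨h.1 ▸ hs, h.2.symm⟩⟩
      simp only [e1, e2, if_false]
      split_ifs <;> simp

/-- The mirror argument: with `d` the predecessor of `j`, `E_{ad}` has commutator `E_{aj} - E_{ld}`,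
where `l` is the predecessor of `a`. The error moves to the left until the line of `a` starts. -/
theorem exists_solvesAd_of_lt_pos (m : Fin n) (j : Fin n) :
    ∀ a : Fin n, blk c a < blk c j → pos c j < pos c a → j < m →
      ∃ N, SolvesAd c (lineMatrix F c) m N (Matrix.single a j 1) := by
  classical
  induction j using WellFoundedLT.induction with
  | _ j ih =>
    intro a hβ hp hj
    obtain ⟨d, hd, hdβ⟩ := exists_prev_left hβ hp.le
    have hdj := lt_of_blk hd.blk_lt
    have h1 := solvesAd_single (c := c) (x := lineMatrix F c) hdβ ((lt_of_blk hβ).trans hj)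
      (hdj.trans hj) 1
    by_cases hnext : ∃ l, Prev c l a
    · obtain ⟨l, hl⟩ := hnext
      obtain ⟨N, hN⟩ := ih d hdj l (hl.blk_lt.trans_le hdβ) (by rw [hl.1, hd.1]; exact hp)
        (hdj.trans hj)
      refine ⟨_, (h1.add hN).congr fun i q hq => ?_⟩
      rw [Matrix.add_apply, single_comm_lineMatrix, Matrix.single_apply, Matrix.single_apply]
      have e1 : (i = a ∧ Prev c d q) ↔ (a = i ∧ j = q) :=
        ⟨fun h => ⟨h.1.symm, hd.right_unique h.2⟩, fun h => ⟨h.1.symm, h.2 ▸ hd⟩⟩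
      have e2 : (Prev c i a ∧ q = d) ↔ (l = i ∧ d = q) :=
        ⟨fun h => ⟨hl.left_unique h.1, h.2.symm⟩, fun h => ⟨h.1 ▸ hl, h.2.symm⟩⟩
      simp only [e1, e2]
      split_ifs <;> simp
    · refine ⟨_, h1.congr fun i q hq => ?_⟩
      rw [single_comm_lineMatrix, Matrix.single_apply]
      have e1 : (i = a ∧ Prev c d q) ↔ (a = i ∧ j = q) :=
        ⟨fun h => ⟨h.1.symm, hd.right_unique h.2⟩, fun h => ⟨h.1.symm, h.2 ▸ hd⟩⟩
      have e2 : ¬ (Prev c i a ∧ q = d) := fun h => hnext ⟨i, h.1⟩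
      simp only [e1, e2, if_false]
      split_ifs <;> simp

/-- The line diagram is a Richardson element. -/
theorem exists_solvesAd_single {m a j : Fin n} (h : c.index a < c.index j) (hj : j < m) :
    ∃ N, SolvesAd c (lineMatrix F c) m N (Matrix.single a j 1) := by
  rcases le_or_gt (pos c a) (pos c j) with hp | hp
  · exact exists_solvesAd_of_pos_le m n a j (by omega) h hp hj
  · exact exists_solvesAd_of_lt_pos m j a h hp hj

end Line

/-! ### The generic matrix is in general position. -/

section Generic

variable (K : Type*) [Field K] {n : ℕ} (c : Composition n)

/-- The generic matrix of `𝔪` over the field `K(𝔪)`. -/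
noncomputable def genericField : Matrix (Fin n) (Fin n) (NilField K c) :=
  (genericMatrix K c).map (algebraMap (NilPoly K c) (NilField K c))

variable {K c}

theorem genericMatrix_of_mem {i j : Fin n} (h : (i, j) ∈ nilRoots c) :
    genericMatrix K c i j = MvPolynomial.X ⟨(i, j), h⟩ := dif_pos h

theorem genericMatrix_of_notMem {i j : Fin n} (h : (i, j) ∉ nilRoots c) :
    genericMatrix K c i j = 0 := dif_neg h

theorem genericField_isNil : IsNil c (genericField K c) := fun i j h => by
  rw [genericField, Matrix.map_apply, genericMatrix_of_notMem h, map_zero]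

/-- The value of a polynomial function at a matrix with entries in an algebra. -/
noncomputable def evalNil {A : Type*} [CommRing A] [Algebra K A] (x : Matrix (Fin n) (Fin n) A) :
    NilPoly K c →ₐ[K] A := MvPolynomial.aeval fun γ => x γ.1.1 γ.1.2

theorem evalNil_genericMatrix {A : Type*} [CommRing A] [Algebra K A]
    {x : Matrix (Fin n) (Fin n) A} (hx : ∀ i j, (i, j) ∉ nilRoots c → x i j = 0) (i j : Fin n) :
    evalNil x (genericMatrix K c i j) = x i j := by
  by_cases h : (i, j) ∈ nilRoots c
  · rw [genericMatrix_of_mem h, evalNil, MvPolynomial.aeval_X]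
  · rw [genericMatrix_of_notMem h, map_zero, hx i j h]

/-- Take the `N` that solve the problem for the line diagram, one for each root of `𝔪` in a column
before `m`. The square matrix of their commutators with the generic matrix specializes to the
identity at the line diagram, so it is invertible over `K(𝔪)`. -/
theorem genericField_rich (m : Fin n) : Rich c (genericField K c) m := by
  classical
  intro Z hZ
  let ι := {γ : nilRoots c // γ.1.2 < m}
  choose N hN using fun γ : ι =>
    exists_solvesAd_single (F := K) (c := c) (a := γ.1.1.1) (j := γ.1.1.2) γ.1.2 γ.2
  let X := genericMatrix K c
  let C : Matrix (Fin n) (Fin n) K → Matrix (Fin n) (Fin n) (NilPoly K c) :=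
    fun A => A.map MvPolynomial.C
  let T : Matrix ι ι (NilPoly K c) := Matrix.of fun γ δ =>
    (C (N δ) * X - X * C (N δ)) γ.1.1.1 γ.1.1.2
  have hT : T.map (evalNil (lineMatrix K c)) = 1 := by
    ext γ δ
    have h1 : ∀ i j, evalNil (lineMatrix K c) ((C (N δ) * X - X * C (N δ)) i j) =
        (N δ * lineMatrix K c - lineMatrix K c * N δ) i j := by
      intro i j
      have hX : ∀ i j, evalNil (lineMatrix K c) (X i j) = lineMatrix K c i j :=
        evalNil_genericMatrix lineMatrix_isNil
      have hC : ∀ i j, evalNil (c := c) (lineMatrix K c) (C (N δ) i j) = N δ i j := fun i j =>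
        (evalNil (lineMatrix K c)).commutes _
      simp only [Matrix.sub_apply, Matrix.mul_apply, map_sub, map_sum, map_mul, hX, hC]
    rw [Matrix.map_apply]
    change evalNil (lineMatrix K c) ((C (N δ) * X - X * C (N δ)) γ.1.1.1 γ.1.1.2) = _
    rw [h1, (hN δ).2.2 _ _ γ.2, Matrix.single_apply,
      Matrix.one_apply]
    have : (δ.1.1.1 = γ.1.1.1 ∧ δ.1.1.2 = γ.1.1.2) ↔ γ = δ := by
      constructor
      · rintro ⟨e1, e2⟩
        exact Subtype.ext (Subtype.ext (Prod.ext e1.symm e2.symm))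
      · rintro rfl
        exact ⟨rfl, rfl⟩
    simp only [this]
  have hdet : T.det ≠ 0 := by
    intro h0
    have := (AlgHom.map_det (evalNil (lineMatrix K c)) T).symm
    rw [h0, map_zero, AlgHom.mapMatrix_apply, hT, Matrix.det_one] at this
    exact one_ne_zero this
  let TF : Matrix ι ι (NilField K c) := T.map (algebraMap _ _)
  have hTF : IsUnit TF.det := by
    have : TF.det = algebraMap _ _ T.det := (RingHom.map_det _ T).symm
    rw [this, isUnit_iff_ne_zero]
    exact fun h => hdet (IsFractionRing.injective (NilPoly K c) (NilField K c)
      (h.trans (map_zero _).symm))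
  let z : ι → NilField K c := TF⁻¹.mulVec fun γ => Z γ.1.1.1 γ.1.1.2
  have hz : TF.mulVec z = fun γ => Z γ.1.1.1 γ.1.1.2 := by
    rw [Matrix.mulVec_mulVec, Matrix.mul_nonsing_inv _ hTF, Matrix.one_mulVec]
  let NF : ι → Matrix (Fin n) (Fin n) (NilField K c) := fun γ =>
    (N γ).map (algebraMap K (NilField K c))
  let G := genericField K c
  have hTNF : ∀ γ δ, TF γ δ = (NF δ * G - G * NF δ) γ.1.1.1 γ.1.1.2 := by
    intro γ δ
    have hG : ∀ i j, G i j = algebraMap _ _ (X i j) := fun _ _ => rfl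
    have hNF : ∀ i j, NF δ i j = algebraMap (NilPoly K c) _ (C (N δ) i j) := fun i j =>
      IsScalarTower.algebraMap_apply K (NilPoly K c) (NilField K c) (N δ i j)
    simp only [TF, T, Matrix.map_apply, Matrix.of_apply, Matrix.sub_apply, Matrix.mul_apply,
      map_sub, map_sum, map_mul, hG, hNF]
  have hpar : IsPar c (∑ γ, z γ • NF γ) := by
    intro i j hij
    rw [Matrix.sum_apply]
    refine Finset.sum_eq_zero fun γ _ => ?_
    change z γ • algebraMap K (NilField K c) (N γ i j) = 0
    rw [(hN γ).1 i j hij, map_zero, smul_zero]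
  refine ⟨∑ γ, z γ • NF γ, hpar, fun i j hij => ?_, fun i j hj => ?_⟩
  · rw [Matrix.sum_apply]
    refine Finset.sum_eq_zero fun γ _ => ?_
    change z γ • algebraMap K (NilField K c) (N γ i j) = 0
    rw [(hN γ).2.1 i j hij, map_zero, smul_zero]
  · by_cases hij : (i, j) ∈ nilRoots c
    · have h1 := congrFun hz ⟨⟨(i, j), hij⟩, hj⟩
      rw [← h1]
      change _ = ∑ δ, TF _ δ * z δ
      have h2 : (∑ γ, z γ • NF γ) * G - G * (∑ γ, z γ • NF γ) =
          ∑ γ, z γ • (NF γ * G - G * NF γ) := by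
        rw [Finset.sum_mul, Finset.mul_sum, ← Finset.sum_sub_distrib]
        refine Finset.sum_congr rfl fun γ _ => ?_
        rw [smul_mul_assoc, mul_smul_comm, smul_sub]
      change ((∑ γ, z γ • NF γ) * G - G * (∑ γ, z γ • NF γ)) i j = _
      rw [h2, Matrix.sum_apply]
      refine Finset.sum_congr rfl fun γ _ => ?_
      rw [hTNF, Matrix.smul_apply, smul_eq_mul, mul_comm]
    · rw [hZ i j hij, Matrix.sub_apply, hpar.mul_isNil genericField_isNil i j hij,
        genericField_isNil.mul_isPar hpar i j hij, sub_zero]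

open Classical in
/-- The sum of the root vectors of the base. -/
noncomputable def baseMatrix (K : Type*) [Field K] (c : Composition n) :
    Matrix (Fin n) (Fin n) K := Matrix.of fun i j => if (i, j) ∈ base c then 1 else 0

/-- The minor on the base rows and columns of the corner becomes the identity when the generic
matrix is specialized to `baseMatrix`. -/
theorem genericField_cornerRank : CornerRank c (genericField K c) := by
  classical
  intro i m _
  let T := cornerCols c i m
  have hT : ∀ t : T, (t : Fin n) ≤ m ∧ ∃ p, i ≤ p ∧ (p, (t : Fin n)) ∈ base c := fun t => by
    simpa [T, cornerCols] using t.2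
  choose row hrow using fun t => (hT t).2
  let A : Matrix T T (NilPoly K c) := (genericMatrix K c).submatrix row (fun t => t)
  have hA : A.map (evalNil (baseMatrix K c)) = 1 := by
    ext s t
    have hnil : ∀ p q, (p, q) ∉ nilRoots c → baseMatrix K c p q = 0 := fun p q h =>
      if_neg fun h' => h (base_subset c h')
    rw [Matrix.map_apply]
    change evalNil (baseMatrix K c) (genericMatrix K c (row s) t) = _
    rw [evalNil_genericMatrix hnil, baseMatrix,
      Matrix.of_apply, Matrix.one_apply]
    have : (row s, (t : Fin n)) ∈ base c ↔ s = t :=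
      ⟨fun h => Subtype.ext (base_row_unique (hrow s).2 h), fun h => h ▸ (hrow s).2⟩
    simp only [this]
  have hdet : A.det ≠ 0 := by
    intro h0
    have := (AlgHom.map_det (evalNil (baseMatrix K c)) A).symm
    rw [h0, map_zero, AlgHom.mapMatrix_apply, hA, Matrix.det_one] at this
    exact one_ne_zero this
  have hsub : (corner (genericField K c) i m).submatrix row (fun t : T => (t : Fin n)) =
      A.map (algebraMap _ _) := by
    ext s t
    rw [Matrix.submatrix_apply, corner, Matrix.of_apply, if_pos ⟨(hrow s).1, (hT t).1⟩]
    rfl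
  have hdetF : (A.map (algebraMap (NilPoly K c) (NilField K c))).det ≠ 0 := by
    have : (A.map (algebraMap (NilPoly K c) (NilField K c))).det = algebraMap _ _ A.det :=
      (RingHom.map_det _ A).symm
    rw [this]
    exact fun h => hdet (IsFractionRing.injective (NilPoly K c) (NilField K c)
      (h.trans (map_zero _).symm))
  calc T.card = Fintype.card T := (Fintype.card_coe T).symm
    _ = (A.map (algebraMap (NilPoly K c) (NilField K c))).rank :=
        (Matrix.rank_of_det_ne_zero hdetF).symm
    _ ≤ _ := by
        rw [← hsub]
        exact Matrix.rank_submatrix_le _ _ _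

/-- The generic matrix is conjugate under the unitriangular group over `K(𝔪)` to a matrix supported
on the extended base. -/
theorem exists_genericField_uniConj :
    ∃ y, UniConj (genericField K c) y ∧ ExtSupported c y ∧ BaseNonzero c y :=
  exists_uniConj_extSupported genericField_isNil genericField_rich genericField_cornerRank

end Generic

/-! ### Explicit descriptions of `S`, `Φ` and `Ψ`. -/

section ExplicitBase

variable {n : ℕ} {c : Composition n}

/-- The right-hand side is shown to be a kernel of `RootGT`. For a root outside it, compare the
position of `i` counted from the bottom of its block with `pos c j`: if it is larger, a smaller root
lies in column `j`; otherwise one lies in row `i`. -/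
theorem mem_base_iff_isPred {i j : Fin n} :
    (i, j) ∈ base c ↔ IsPred c (blk c i) (blk c j) (pos c j) ∧
      pos c i + pos c j + 1 = blockSize c (blk c i) := by
  let A : Set (Fin n × Fin n) := {γ | IsPred c (blk c γ.1) (blk c γ.2) (pos c γ.2) ∧
    pos c γ.1 + pos c γ.2 + 1 = blockSize c (blk c γ.1)}
  have hlt : ∀ γ ∈ A, γ.1 < γ.2 := fun γ h => lt_of_blk h.1.1
  suffices h : A = base c by rw [← h]; rfl
  refine eq_base_of_kernel c A fun γ => ⟨fun h => ⟨h.1.1, fun ξ hξ hgt => ?_⟩, fun h => ?_⟩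
  · obtain ⟨i, j⟩ := γ
    obtain ⟨k, l⟩ := ξ
    rw [rootGT_iff (hlt _ h) (hlt _ hξ)] at hgt
    obtain ⟨h1, h2⟩ := h
    obtain ⟨h3, h4⟩ := hξ
    simp only at h1 h2 h3 h4 hgt
    rcases hgt with ⟨rfl, hlj⟩ | ⟨rfl, hik⟩
    · have hp : pos c l = pos c j := by omega
      rw [hp] at h3
      have hb := h3.unique_right h1 (hp ▸ pos_lt l) (pos_lt j)
      exact hlj.ne (eq_of_blk_pos hb hp)
    · have hb := h1.unique h3
      refine hik.ne (eq_of_blk_pos hb ?_)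
      rw [hb] at h2
      omega
  · obtain ⟨i, j⟩ := γ
    obtain ⟨hij, hno⟩ := h
    replace hij : blk c i < blk c j := hij
    have hi := pos_lt (c := c) i
    have hj := pos_lt (c := c) j
    have row : ∀ s, s ≤ blk c j → IsPred c (blk c i) s (blockSize c (blk c i) - 1 - pos c i) →
        blockSize c (blk c i) - 1 - pos c i < blockSize c s →
        (s = blk c j → blockSize c (blk c i) - 1 - pos c i < pos c j) → False := by
      intro s hs hp hk hlast
      obtain ⟨l, rfl, hl⟩ := exists_blk_pos hk
      have hA : (i, l) ∈ A := ⟨hl ▸ hp, by simp only; omega⟩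
      refine hno _ hA ((rootGT_iff (lt_of_blk hij) (hlt _ hA)).mpr (Or.inl ⟨rfl, ?_⟩))
      rcases hs.lt_or_eq with hs | hs
      · exact lt_of_blk hs
      · exact lt_of_pos hs (hl ▸ hlast hs)
    rcases lt_trichotomy (blockSize c (blk c i) - 1 - pos c i) (pos c j) with hκ | hκ | hκ
    · obtain ⟨s, hs, hp, hk⟩ := exists_isPred_right (c := c) hij
        (k := blockSize c (blk c i) - 1 - pos c i) (by omega) (by omega)
      exact (row s hs hp hk fun _ => hκ).elim
    · by_cases hp : IsPred c (blk c i) (blk c j) (pos c j)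
      · exact ⟨hp, by simp only; omega⟩
      · have : ∃ b, blk c i < b ∧ b < blk c j ∧ pos c j < blockSize c b := by
          by_contra! hall
          exact hp ⟨hij, by omega, hall⟩
        obtain ⟨b, h1, h2, h3⟩ := this
        obtain ⟨s, hs, hp, hk⟩ := exists_isPred_right (c := c) h1
          (k := blockSize c (blk c i) - 1 - pos c i) (by omega) (by omega)
        exact (row s (hs.trans h2.le) hp hk fun h => by omega).elim
    · obtain ⟨b, hb, hp⟩ := exists_isPred (c := c) (k := pos c j) hij (by omega)
      have hpb := hp.2.1
      obtain ⟨k, rfl, hk⟩ := exists_blk_pos (c := c) (b := b)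
        (k := blockSize c b - 1 - pos c j) (by omega)
      have hA : (k, j) ∈ A := ⟨hp, by simp only; omega⟩
      refine (hno _ hA ((rootGT_iff (lt_of_blk hij) (hlt _ hA)).mpr (Or.inr ⟨rfl, ?_⟩))).elim
      rcases hb.lt_or_eq with hb | hb
      · exact lt_of_blk hb
      · refine lt_of_pos hb ?_
        rw [hb] at hκ hi
        simp only
        omega

/-- A block before the block `b`, not before the block `l`, has more than `q` indices. -/
def Exceeds (c : Composition n) (l b q : ℕ) : Prop := ∃ s, l ≤ s ∧ s < b ∧ q < blockSize c s

theorem Exceeds.mono {l l' b q q' : ℕ} (h : Exceeds c l b q) (hl : l' ≤ l) (hq : q' ≤ q) :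
    Exceeds c l' b q' := by
  obtain ⟨s, h1, h2, h3⟩ := h
  exact ⟨s, hl.trans h1, h2, hq.trans_lt h3⟩

theorem exists_base_col_iff {j : Fin n} :
    (∃ i, (i, j) ∈ base c) ↔ Exceeds c 0 (blk c j) (pos c j) := by
  constructor
  · rintro ⟨i, h⟩
    have := (mem_base_iff_isPred.mp h).1
    exact ⟨blk c i, Nat.zero_le _, this.1, this.2.1⟩
  · rintro ⟨s, -, h1, h2⟩
    obtain ⟨b, -, hp⟩ := exists_isPred h1 h2
    have hk := hp.2.1
    obtain ⟨i, rfl, hi⟩ := exists_blk_pos (c := c) (b := b)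
      (k := blockSize c b - 1 - pos c j) (by omega)
    exact ⟨i, mem_base_iff_isPred.mpr ⟨hp, by omega⟩⟩

theorem mem_phi_iff_isPred {i j : Fin n} :
    (i, j) ∈ phi c ↔ IsPred c (blk c i) (blk c j) (pos c j) ∧
      pos c i + pos c j + 1 < blockSize c (blk c i) ∧ Exceeds c 0 (blk c i) (pos c i) := by
  rw [mem_phi_iff, exists_base_col_iff]
  constructor
  · rintro ⟨h1, k, hik, hβ, hk⟩
    rw [index_eq_iff] at hβ
    obtain ⟨hp, hpos⟩ := mem_base_iff_isPred.mp hk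
    have := pos_lt_of_lt hβ hik
    rw [← hβ] at hp hpos
    exact ⟨hp, by omega, h1⟩
  · rintro ⟨hp, hpos, h1⟩
    obtain ⟨k, hb, hk⟩ := exists_blk_pos (c := c) (b := blk c i)
      (k := blockSize c (blk c i) - 1 - pos c j) (by omega)
    refine ⟨h1, k, lt_of_pos hb.symm (by omega), index_eq_iff.mpr hb.symm, ?_⟩
    rw [mem_base_iff_isPred, hb]
    exact ⟨hp, by omega⟩

theorem mem_extBase_iff_isPred {i j : Fin n} :
    (i, j) ∈ extBase c ↔ IsPred c (blk c i) (blk c j) (pos c j) ∧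
      (pos c i + pos c j + 1 = blockSize c (blk c i) ∨
        pos c i + pos c j + 1 < blockSize c (blk c i) ∧ Exceeds c 0 (blk c i) (pos c i)) := by
  rw [extBase, Set.mem_union, mem_base_iff_isPred, mem_phi_iff_isPred]
  tauto

theorem psi_subset_phi : psi c ⊆ phi c := Set.union_subset (fun _ h => h.1) fun _ h => h.1

theorem psi_subset_extBase : psi c ⊆ extBase c := psi_subset_phi.trans Set.subset_union_right

/-- If any rectangle of the required kind exists, one exists with the next row of the block and a
column in position `pos c j - 1`. The condition on the next row is that its index is the column of a
base root. -/
theorem mem_psiOne_iff {i j : Fin n} :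
    (i, j) ∈ psiOne c ↔ (i, j) ∈ phi c ∧ 1 ≤ pos c j ∧ Exceeds c 0 (blk c i) (pos c i + 1) := by
  refine and_congr_right fun hφ => ?_
  obtain ⟨hp, hpos, -⟩ := mem_phi_iff_isPred.mp hφ
  constructor
  · rintro ⟨k, a, hik, haj, hia, hka, hkj⟩
    simp only at hik haj hia hka hkj
    rw [mem_extBase_iff_isPred] at hia hka hkj
    have hb : blk c i = blk c k := hp.unique hkj.1
    have hik' := pos_lt_of_lt hb hik
    rw [← hb] at hka hkj
    have hsle := blk_mono (c := c) haj.le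
    refine ⟨?_, ?_⟩
    · rcases hsle.lt_or_eq with h | h
      · have := hp.2.2 _ hka.1.1 h
        have := pos_lt (c := c) a
        omega
      · have := pos_lt_of_lt h haj
        omega
    · rcases hkj.2 with h | h
      · rcases hka.2 with h' | h'
        · have hpa : pos c a = pos c j := by omega
          have := hka.1
          rw [hpa] at this
          exact absurd (eq_of_blk_pos (this.unique_right hp (hpa ▸ pos_lt a) (pos_lt j)) hpa) haj.ne
        · exact h'.2.mono le_rfl (by omega)
      · exact h.2.mono le_rfl (by omega)
  · rintro ⟨hk, hex⟩
    have hj := pos_lt (c := c) j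
    obtain ⟨k, hb, hpk⟩ := exists_blk_pos (c := c) (b := blk c i) (k := pos c i + 1) (by omega)
    obtain ⟨s, hs, hps, hks⟩ := exists_isPred_right (c := c) hp.1 (k := pos c j - 1)
      (by omega) (by omega)
    obtain ⟨a, rfl, ha⟩ := exists_blk_pos hks
    rw [← ha] at hps
    refine ⟨k, a, lt_of_pos hb.symm (by simp only; omega), ?_, ?_, ?_, ?_⟩
    · rcases hs.lt_or_eq with h | h
      · exact lt_of_blk h
      · exact lt_of_pos h (by simp only; omega)
    · simp only
      rw [mem_extBase_iff_isPred]
      exact ⟨hps, Or.inr ⟨by omega, hex.mono le_rfl (by omega)⟩⟩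
    · rw [mem_extBase_iff_isPred, hb, hpk]
      exact ⟨hps, Or.inr ⟨by omega, hex⟩⟩
    · simp only
      rw [mem_extBase_iff_isPred, hb, hpk]
      refine ⟨hp, ?_⟩
      rcases (Nat.succ_le_of_lt hpos).lt_or_eq with h | h
      · exact Or.inr ⟨by omega, hex⟩
      · exact Or.inl (by omega)

/-- The roots of `Φ` in the first row of a block other than the initial one have distinct column
positions below the block size minus one; having `pos c i + 1` of them means that the block has more
than `pos c i + 1` indices. In the initial block there are none, hence the bound `1` in `Exceeds`.
-/
theorem mem_psiTwo_iff {i j : Fin n} :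
    (i, j) ∈ psiTwo c ↔ (i, j) ∈ phi c ∧ pos c j = 0 ∧ Exceeds c 1 (blk c i) (pos c i + 1) := by
  refine and_congr_right fun hφ => ?_
  obtain ⟨hp, hpos, -⟩ := mem_phi_iff_isPred.mp hφ
  have blk_pos : ∀ {i : Fin n} {b k : ℕ}, k < blockSize c b → (i : ℕ) = c.sizeUpTo b + k →
      blk c i = b ∧ pos c i = k := by
    intro i b k hk hi
    obtain ⟨i', rfl, rfl⟩ := exists_blk_pos hk
    have : i = i' := Fin.ext (by rw [hi, ← val_eq])
    exact this ▸ ⟨rfl, rfl⟩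
  constructor
  · rintro ⟨t, k, hk1, hkt, hi, hj, s, hst, i₀, hi₀, f, hf, hfφ⟩
    simp only at hi hj
    rw [← blockSize_eq] at hkt
    obtain ⟨hbi, hpi⟩ := blk_pos (i := i) (b := t) (k := k - 1) (by omega) (by omega)
    have hpos0 : 0 < blockSize c (t + 1) := by
      rw [blockSize_pos]
      have := blk_lt_length (c := c) j
      have := hp.1
      omega
    obtain ⟨hbj, hpj⟩ := blk_pos (i := j) hpos0 hj
    have hs0 : 0 < blockSize c s := blockSize_pos.mpr s.2
    obtain ⟨hb0, hp0⟩ := blk_pos (i := i₀) hs0 hi₀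
    have hφ' := fun m => mem_phi_iff_isPred.mp (hfφ m)
    simp only [hb0, hp0] at hφ'
    refine ⟨hpj, s, ?_, hbi ▸ hst, ?_⟩
    · obtain ⟨s', -, hs', -⟩ := (hφ' ⟨0, hk1⟩).2.2
      omega
    · have hinj : Function.Injective fun m : Fin k =>
          (⟨pos c (f m), by have := (hφ' m).2.1; omega⟩ : Fin (blockSize c s - 1)) := by
        intro m m' h
        have hpe : pos c (f m) = pos c (f m') := congrArg Fin.val h
        have h1 := (hφ' m).1
        rw [hpe] at h1
        exact hf.injective (eq_of_blk_pos
          (h1.unique_right (hφ' m').1 (hpe ▸ pos_lt _) (pos_lt _)) hpe)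
      have := Fintype.card_le_of_injective _ hinj
      simp only [Fintype.card_fin] at this
      omega
  · rintro ⟨hj0, s, hs1, hsb, hs⟩
    have hb1 : blk c j = blk c i + 1 := by
      by_contra hne
      have hlt := hp.1
      have := hp.2.2 (blk c i + 1) (by omega) (by omega)
      have h0 : 0 < blockSize c (blk c i + 1) :=
        blockSize_pos.mpr (lt_of_le_of_lt (by omega) (blk_lt_length (c := c) j))
      omega
    have hslt : s < c.length := hsb.trans (blk_lt_length i)
    have hs0 : 0 < blockSize c s := blockSize_pos.mpr hslt
    obtain ⟨i₀, hb0, hp0⟩ := exists_blk_pos hs0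
    have hnext : ∀ m : Fin (pos c i + 1), ∃ l, pos c l = m ∧ IsPred c s (blk c l) m := by
      intro m
      obtain ⟨t, ht, hpt, hmt⟩ := exists_isPred_right (c := c) hsb (k := m)
        (by omega) (by omega)
      obtain ⟨l, rfl, hl⟩ := exists_blk_pos hmt
      exact ⟨l, hl, hpt⟩
    choose f hf1 hf2 using hnext
    refine ⟨c.index i, pos c i + 1, by omega, ?_, ?_, ?_, ⟨s, hslt⟩, hsb, i₀, ?_, f, ?_, ?_⟩
    · rw [← blockSize_eq]
      change _ < blockSize c (blk c i)
      omega
    · have := val_eq (c := c) i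
      unfold blk at this
      simp only
      omega
    · have := val_eq (c := c) j
      rw [hb1, hj0] at this
      exact this
    · rw [val_eq (c := c) i₀, hb0, hp0, add_zero]
    · intro m m' hmm
      have hlt : pos c (f m) < pos c (f m') := by rw [hf1, hf1]; exact hmm
      rcases lt_trichotomy (blk c (f m)) (blk c (f m')) with h | h | h
      · exact lt_of_blk h
      · exact lt_of_pos h hlt
      · have h1 := (hf2 m).2.2 _ (hf2 m').1 h
        have h2 := pos_lt (c := c) (f m')
        rw [hf1] at h2 hlt
        rw [hf1] at hlt
        omega
    · intro m
      rw [mem_phi_iff_isPred, hb0, hp0, hf1]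
      exact ⟨hf2 m, by omega, 0, le_rfl, by omega,
        blockSize_pos.mpr (lt_of_le_of_lt (Nat.zero_le _) hslt)⟩

/-- The truncated difference `1 - pos c j` merges the two series: it excludes the initial block
exactly when `j` is first in its block. -/
theorem mem_psi_iff {i j : Fin n} :
    (i, j) ∈ psi c ↔ (i, j) ∈ phi c ∧ Exceeds c (1 - pos c j) (blk c i) (pos c i + 1) := by
  rw [psi, Set.mem_union, mem_psiOne_iff, mem_psiTwo_iff, ← and_or_left]
  refine and_congr_right fun _ => ?_
  rcases Nat.eq_zero_or_pos (pos c j) with h | h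
  · simp [h]
  · have h1 : 1 - pos c j = 0 := by omega
    simp [h1, Nat.one_le_iff_ne_zero, h.ne']

end ExplicitBase

/-! ### The roots of `(S ∪ Φ) \ Ψ` form a forest, with both ends of each root of `Ψ` in one
component. -/

section Forest

variable {n : ℕ} {c : Composition n}

/-- The roots of the extended base outside `Ψ`. -/
def tree (c : Composition n) : Set (Fin n × Fin n) := extBase c \ psi c

theorem mem_tree_iff {i j : Fin n} :
    (i, j) ∈ tree c ↔ IsPred c (blk c i) (blk c j) (pos c j) ∧
      (pos c i + pos c j + 1 = blockSize c (blk c i) ∨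
        pos c i + pos c j + 1 < blockSize c (blk c i) ∧ Exceeds c 0 (blk c i) (pos c i) ∧
          ¬ Exceeds c (1 - pos c j) (blk c i) (pos c i + 1)) := by
  rw [tree, Set.mem_sdiff, mem_extBase_iff_isPred, mem_psi_iff, mem_phi_iff_isPred]
  constructor
  · rintro ⟨⟨h1, h2 | h2⟩, h3⟩
    · exact ⟨h1, Or.inl h2⟩
    · exact ⟨h1, Or.inr ⟨h2.1, h2.2, fun h => h3 ⟨⟨h1, h2⟩, h⟩⟩⟩
  · rintro ⟨h1, h2 | h2⟩
    · exact ⟨⟨h1, Or.inl h2⟩, fun h => by omega⟩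
    · exact ⟨⟨h1, Or.inr ⟨h2.1, h2.2.1⟩⟩, fun h => h2.2.2 h.2⟩

open Classical in
/-- The last block before the block `s` that has more than `k` indices, zero if there is none. -/
noncomputable def lastPred (c : Composition n) (s k : ℕ) : ℕ :=
  if h : ∃ b, IsPred c b s k then h.choose else 0

theorem IsPred.lastPred_eq {b s k : ℕ} (h : IsPred c b s k) : lastPred c s k = b := by
  have hex : ∃ b, IsPred c b s k := ⟨b, h⟩
  rw [lastPred, dif_pos hex]
  exact hex.choose_spec.unique h

theorem lastPred_lt {s k : ℕ} (h : 0 < s) : lastPred c s k < s := by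
  unfold lastPred
  split_ifs with h'
  · exact h'.choose_spec.1
  · exact h

open Classical in
/-- A rank function on the indices that decreases along the edges of the forest. -/
noncomputable def treeRank (c : Composition n) (v : Fin n) : ℕ :=
  if Exceeds c 1 (blk c v) (pos c v) then
    4 * lastPred c (blk c v) (pos c v) + if pos c v = 0 then 1 else 3
  else if Exceeds c 0 (blk c v) (pos c v) then 4 * blk c v + 2 else 4 * c.length + 4

/-- In this case `i` is the parent of `j`. An index below which only the initial block exceeds has
offset 2, strictly between offset 1 of its neighbours in position 0 and offset 3 of those in
positive position; this orients the edges at it. -/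
theorem treeRank_row_lt {i j : Fin n} (h : (i, j) ∈ tree c)
    (hD : Exceeds c (1 - pos c j) (blk c i) (pos c i)) : treeRank c i < treeRank c j := by
  have hp := (mem_tree_iff.mp h).1
  have hi1 : 1 ≤ blk c i := by
    obtain ⟨s, -, h2, -⟩ := hD
    omega
  have hj : Exceeds c 1 (blk c j) (pos c j) := ⟨blk c i, hi1, hp.1, hp.2.1⟩
  have h1 : treeRank c j = 4 * blk c i + if pos c j = 0 then 1 else 3 := by
    rw [treeRank, if_pos hj, hp.lastPred_eq]
  rw [h1, treeRank]
  have h2 := lastPred_lt (c := c) (k := pos c i) hi1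
  split_ifs with h3 h4 h5 h5 h6 h6 <;> try omega
  · rw [h6] at hD
    exact absurd hD h3
  · exact absurd (hD.mono (Nat.zero_le _) le_rfl) ‹¬ Exceeds c 0 _ _›
  · exact absurd (hD.mono (Nat.zero_le _) le_rfl) ‹¬ Exceeds c 0 _ _›

theorem not_exceeds_of_not {b q k : ℕ} (hD : ¬ Exceeds c (1 - k) b q) : ¬ Exceeds c 1 b q :=
  fun h => hD (h.mono (by omega) le_rfl)

theorem treeRank_col_lt {i j : Fin n} (h : (i, j) ∈ tree c)
    (hD : ¬ Exceeds c (1 - pos c j) (blk c i) (pos c i)) : treeRank c j < treeRank c i := by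
  have hp := (mem_tree_iff.mp h).1
  have hl := blk_lt_length (c := c) j
  have hj0 : Exceeds c 0 (blk c j) (pos c j) := ⟨blk c i, Nat.zero_le _, hp.1, hp.2.1⟩
  have hji := hp.1
  by_cases hi : Exceeds c 0 (blk c i) (pos c i)
  · have hk : pos c j = 0 := by
      by_contra hk
      rw [show 1 - pos c j = 0 by omega] at hD
      exact hD hi
    have hi1 : 1 ≤ blk c i := by
      obtain ⟨s, -, h2, -⟩ := hi
      omega
    have hj : Exceeds c 1 (blk c j) (pos c j) := ⟨blk c i, hi1, hp.1, hp.2.1⟩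
    rw [treeRank, treeRank, if_pos hj, if_neg (not_exceeds_of_not hD), if_pos hi, hp.lastPred_eq,
      if_pos hk]
    omega
  · rw [treeRank, treeRank, if_neg (not_exceeds_of_not hD), if_neg hi, hp.lastPred_eq, if_pos hj0]
    split_ifs <;> omega

/-- The index `w` is the parent of `v` in the forest. -/
def Parent (c : Composition n) (v w : Fin n) : Prop :=
  (w, v) ∈ tree c ∧ Exceeds c (1 - pos c v) (blk c w) (pos c w) ∨
    (v, w) ∈ tree c ∧ ¬ Exceeds c (1 - pos c w) (blk c v) (pos c v)

theorem Parent.treeRank_lt {v w : Fin n} (h : Parent c v w) : treeRank c w < treeRank c v :=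
  h.elim (fun h => treeRank_row_lt h.1 h.2) fun h => treeRank_col_lt h.1 h.2

theorem parent_or_parent {i j : Fin n} (h : (i, j) ∈ tree c) : Parent c i j ∨ Parent c j i := by
  by_cases hD : Exceeds c (1 - pos c j) (blk c i) (pos c i)
  · exact Or.inr (Or.inl ⟨h, hD⟩)
  · exact Or.inl (Or.inr ⟨h, hD⟩)

theorem not_row_child_of_col_child {v w w' : Fin n} (h : (w, v) ∈ tree c)
    (hD : Exceeds c (1 - pos c v) (blk c w) (pos c w))
    (hD' : ¬ Exceeds c (1 - pos c w') (blk c v) (pos c v)) : False := by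
  have hp := (mem_tree_iff.mp h).1
  have hw : 1 ≤ blk c w := by
    obtain ⟨s, -, h2, -⟩ := hD
    omega
  exact not_exceeds_of_not hD' ⟨blk c w, hw, hp.1, hp.2.1⟩

/-- Both rows lie in the same block; if `w` were the upper one, the condition at `w'` would pass to
the row just below `w` and place `(w, v)` in `Ψ`. -/
theorem not_pos_lt_of_col_child {v w w' : Fin n} (h : (w, v) ∈ tree c) (h' : (w', v) ∈ tree c)
    (hD' : Exceeds c (1 - pos c v) (blk c w') (pos c w')) : ¬ pos c w < pos c w' := by
  intro hlt
  obtain ⟨hp, he⟩ := mem_tree_iff.mp h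
  obtain ⟨hp', he'⟩ := mem_tree_iff.mp h'
  have hb := hp.unique hp'
  rw [← hb] at he' hD'
  rcases he with he | ⟨-, -, he⟩
  · omega
  · exact he (hD'.mono le_rfl hlt)

theorem Parent.unique {v w w' : Fin n} (h : Parent c v w) (h' : Parent c v w') : w = w' := by
  rcases h with ⟨h, hD⟩ | ⟨h, hD⟩ <;> rcases h' with ⟨h', hD'⟩ | ⟨h', hD'⟩
  · refine eq_of_blk_pos ((mem_tree_iff.mp h).1.unique (mem_tree_iff.mp h').1) ?_
    have h1 := not_pos_lt_of_col_child h h' hD'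
    have h2 := not_pos_lt_of_col_child h' h hD
    omega
  · exact (not_row_child_of_col_child h hD hD').elim
  · exact (not_row_child_of_col_child h' hD' hD).elim
  · obtain ⟨hp, he⟩ := mem_tree_iff.mp h
    obtain ⟨hp', he'⟩ := mem_tree_iff.mp h'
    have hk : pos c w = pos c w' := by
      by_cases hv : Exceeds c 0 (blk c v) (pos c v)
      · have aux : ∀ k, ¬ Exceeds c (1 - k) (blk c v) (pos c v) → k = 0 := by
          intro k hk
          by_contra h0
          rw [show 1 - k = 0 by omega] at hk
          exact hk hv
        rw [aux _ hD, aux _ hD']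
      · rcases he with he | he
        · rcases he' with he' | he'
          · omega
          · exact absurd he'.2.1 hv
        · exact absurd he.2.1 hv
    rw [← hk] at hp'
    exact eq_of_blk_pos (hp.unique_right hp' (pos_lt w) (hk ▸ pos_lt w')) hk

/-- The edges of the forest are independent: the differences along them can be prescribed. -/
theorem exists_sub_eq_on_tree (y : Fin n × Fin n → ℤ) :
    ∃ t : Fin n → ℤ, ∀ i j, (i, j) ∈ tree c → t i - t j = y (i, j) := by
  classical
  -- The prescribed difference from child to parent, with the sign given by the direction of the
  -- root. Values are assigned by increasing `treeRank`.
  let step (v w : Fin n) : ℤ := if (v, w) ∈ tree c then y (v, w) else - y (w, v)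
  have key : ∀ N : ℕ, ∃ t : Fin n → ℤ, ∀ v w, treeRank c v < N → Parent c v w →
      t v - t w = step v w := by
    intro N
    induction N with
    | zero => exact ⟨0, fun v w h => by omega⟩
    | succ N ih =>
      obtain ⟨t, ht⟩ := ih
      refine ⟨fun v => if h : treeRank c v = N ∧ ∃ w, Parent c v w then
        t h.2.choose + step v h.2.choose else t v, fun v w hv hw => ?_⟩
      have hwv := hw.treeRank_lt
      have hwN : treeRank c w ≠ N := by omega
      simp only
      rw [dif_neg (fun h : treeRank c w = N ∧ _ => hwN h.1)]
      by_cases hvN : treeRank c v = N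
      · have hex : treeRank c v = N ∧ ∃ w, Parent c v w := ⟨hvN, w, hw⟩
        rw [dif_pos hex, hex.2.choose_spec.unique hw, add_sub_cancel_left]
      · rw [dif_neg (fun h : treeRank c v = N ∧ _ => hvN h.1)]
        exact ht v w (by omega) hw
  obtain ⟨N, hN⟩ : ∃ N, ∀ v : Fin n, treeRank c v < N :=
    ⟨Finset.univ.sup (treeRank c) + 1, fun v =>
      Nat.lt_succ_of_le (Finset.le_sup (f := treeRank c) (Finset.mem_univ v))⟩
  obtain ⟨t, ht⟩ := key N
  refine ⟨t, fun i j hij => ?_⟩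
  have hji : (j, i) ∉ tree c := fun h =>
    (extBase_index_lt h.1).asymm (extBase_index_lt hij.1)
  rcases parent_or_parent hij with h | h
  · have := ht i j (hN i) h
    simpa [step, hij] using this
  · have := ht j i (hN j) h
    simp only [step, hji, if_false] at this
    omega

/-- The indices in the connected component of the forest that contains the endpoints of `Ψ`. -/
def Active (c : Composition n) (v : Fin n) : Prop :=
  Exceeds c 1 (blk c v) (pos c v) ∨
    1 ≤ blk c v ∧ Exceeds c 0 (blk c v) (pos c v) ∧ blk c v + 1 < c.length

/-- From an active index the parents form a path of active indices of decreasing rank. It can only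
end at the first index of the block numbered 2, so all active indices lie in one component. -/
theorem eq_on_active {α : Type*} {γ : Fin n → α} (hγ : ∀ i j, (i, j) ∈ tree c → γ i = γ j)
    (N : ℕ) : ∀ v, treeRank c v < N → Active c v → ∃ r, blk c r = 2 ∧ pos c r = 0 ∧ γ v = γ r := by
  classical
  induction N with
  | zero => intro v h; omega
  | succ N ih =>
    intro v hN hv
    by_cases hold : Exceeds c 1 (blk c v) (pos c v)
    · obtain ⟨s, h1, h2, h3⟩ := hold
      obtain ⟨b, hb, hp⟩ := exists_isPred h2 h3
      by_cases hD : Exceeds c (1 - pos c v) b 0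
      · let P : ℕ → Prop := fun q => Exceeds c (1 - pos c v) b q
        -- The parent in column `v` is the lowest row, not below the base row, that satisfies `P`:
        -- either it is the base row or the row after it fails `P`, so its root is not in `Ψ`.
        let q := Nat.findGreatest P (blockSize c b - 1 - pos c v)
        have hq : q ≤ blockSize c b - 1 - pos c v := Nat.findGreatest_le _
        have hPq : P q := Nat.findGreatest_spec (P := P) (Nat.zero_le _) hD
        have hk := hp.2.1
        obtain ⟨w, rfl, hw⟩ := exists_blk_pos (c := c) (b := b) (k := q) (by omega)
        have hPw : Exceeds c (1 - pos c v) (blk c w) (pos c w) := hw ▸ hPq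
        have hwv : (w, v) ∈ tree c := by
          refine mem_tree_iff.mpr ⟨hp, ?_⟩
          rcases hq.lt_or_eq with h | h
          · refine Or.inr ⟨by omega, hPw.mono (Nat.zero_le _) le_rfl, ?_⟩
            rw [hw]
            exact Nat.findGreatest_is_greatest (P := P) (Nat.lt_succ_self q) h
          · exact Or.inl (by omega)
        have hlt := treeRank_row_lt hwv hPw
        have hl := blk_lt_length (c := c) v
        have hpw := hp.1
        obtain ⟨r, hr1, hr2, hr3⟩ := ih w (by omega)
          (Or.inr ⟨h1.trans hb, hPw.mono (Nat.zero_le _) le_rfl, by omega⟩)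
        exact ⟨r, hr1, hr2, (hγ w v hwv).symm.trans hr3⟩
      · have hl := blk_lt_length (c := c) v
        have hpos : ∀ s', s' < blk c v → 0 < blockSize c s' := fun s' h =>
          blockSize_pos.mpr (h.trans hl)
        have hpb := hp.1
        have hb1 : b = 1 := by
          by_contra hne
          exact hD ⟨1, by omega, by omega, hpos 1 (by omega)⟩
        have hk0 : pos c v = 0 := by
          by_contra hne
          exact hD ⟨0, by omega, by omega, hpos 0 (by omega)⟩
        refine ⟨v, ?_, hk0, rfl⟩
        by_contra hne
        have h4 := hp.2.2 2 (by omega) (by omega)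
        have h5 := hpos 2 (by omega)
        omega
    · obtain ⟨h1, h2, h3⟩ := hv.resolve_left hold
      obtain ⟨w, hw, hw0⟩ := exists_blk_pos (c := c) (b := blk c v + 1) (k := 0)
        (blockSize_pos.mpr h3)
      have hv' := pos_lt (c := c) v
      have hD : ¬ Exceeds c (1 - pos c w) (blk c v) (pos c v) := by rwa [hw0]
      have hp : IsPred c (blk c v) (blk c w) (pos c w) := by
        rw [hw, hw0]
        exact ⟨by omega, by omega, fun b' _ _ => by omega⟩
      have hvw : (v, w) ∈ tree c := by
        refine mem_tree_iff.mpr ⟨hp, ?_⟩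
        rw [hw0]
        rcases (Nat.succ_le_of_lt hv').lt_or_eq with h | h
        · exact Or.inr ⟨by omega, h2, fun h => hold (h.mono le_rfl (Nat.le_succ _))⟩
        · exact Or.inl (by omega)
      have hlt := treeRank_col_lt hvw hD
      obtain ⟨r, hr1, hr2, hr3⟩ := ih w (by omega) (Or.inl ⟨blk c v, h1, hp.1, hp.2.1⟩)
      exact ⟨r, hr1, hr2, (hγ v w hvw).trans hr3⟩

/-- The endpoints of the roots of `Ψ` are connected in the forest. -/
theorem eq_on_psi {α : Type*} {γ : Fin n → α} (hγ : ∀ i j, (i, j) ∈ tree c → γ i = γ j)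
    {i j : Fin n} (h : (i, j) ∈ psi c) : γ i = γ j := by
  obtain ⟨hφ, hD⟩ := mem_psi_iff.mp h
  obtain ⟨hp, -, hex⟩ := mem_phi_iff_isPred.mp hφ
  have hi1 : 1 ≤ blk c i := by
    obtain ⟨s, -, h2, -⟩ := hD
    omega
  have hl := blk_lt_length (c := c) j
  have hij := hp.1
  obtain ⟨r, hr1, hr2, hr3⟩ := eq_on_active hγ _ i (Nat.lt_succ_self _)
    (Or.inr ⟨hi1, hex, by omega⟩)
  obtain ⟨r', hr1', hr2', hr3'⟩ := eq_on_active hγ _ j (Nat.lt_succ_self _)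
    (Or.inl ⟨blk c i, hi1, hp.1, hp.2.1⟩)
  rw [hr3, hr3', eq_of_blk_pos (hr1.trans hr1'.symm) (hr2.trans hr2'.symm)]

end Forest

/-! ### Normalization by the torus. -/

section Torus

variable {n : ℕ} {c : Composition n}

/-- Integral exponents make the normalizing torus element a Laurent monomial in the entries on the
forest. Off the forest the exponent is zero, so entries that may vanish are never inverted. -/
theorem exists_treeExp (c : Composition n) (e : Fin n × Fin n) : ∃ t : Fin n → ℤ,
    (e ∉ tree c → t = 0) ∧ ∀ i j, (i, j) ∈ tree c → t i - t j = if (i, j) = e then 1 else 0 := by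
  by_cases he : e ∈ tree c
  · obtain ⟨t, ht⟩ := exists_sub_eq_on_tree (c := c) fun e' => if e' = e then 1 else 0
    exact ⟨t, fun h => absurd he h, ht⟩
  · refine ⟨0, fun _ => rfl, fun i j hij => ?_⟩
    rw [if_neg fun h : (i, j) = e => he (h ▸ hij)]
    rfl

/-- Exponents of the entry at `e` in the diagonal matrix that makes the entries of a matrix at the
edges of the forest equal to one. -/
noncomputable def treeExp (c : Composition n) (e : Fin n × Fin n) : Fin n → ℤ :=
  (exists_treeExp c e).choose

theorem treeExp_of_notMem {e : Fin n × Fin n} (h : e ∉ tree c) : treeExp c e = 0 :=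
  (exists_treeExp c e).choose_spec.1 h

theorem treeExp_sub {i j : Fin n} (h : (i, j) ∈ tree c) (e : Fin n × Fin n) :
    treeExp c e i - treeExp c e j = if (i, j) = e then 1 else 0 :=
  (exists_treeExp c e).choose_spec.2 i j h

variable {F : Type*} [Field F] {y : Matrix (Fin n) (Fin n) F}

/-- The entries of the diagonal matrix that makes the entries of `y` at the edges of the forest
equal to one. -/
noncomputable def torus (c : Composition n) (y : Matrix (Fin n) (Fin n) F) (i : Fin n) : F :=
  ∏ e : Fin n × Fin n, y e.1 e.2 ^ treeExp c e i

theorem torus_ne_zero (hy : ∀ i j, (i, j) ∈ tree c → y i j ≠ 0) (i : Fin n) : torus c y i ≠ 0 := by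
  refine Finset.prod_ne_zero_iff.mpr fun e _ => ?_
  by_cases he : e ∈ tree c
  · exact zpow_ne_zero _ (hy e.1 e.2 he)
  · rw [treeExp_of_notMem he, Pi.zero_apply, zpow_zero]
    exact one_ne_zero

theorem map_torus {F' : Type*} [Field F'] (σ : F →+* F') (i : Fin n) :
    σ (torus c y i) = torus c (y.map σ) i := by
  simp only [torus, map_prod, map_zpow₀, Matrix.map_apply]

theorem torus_eq (hy : ∀ i j, (i, j) ∈ tree c → y i j ≠ 0) {i j : Fin n} (h : (i, j) ∈ tree c) :
    torus c y i = torus c y j * y i j := by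
  have h1 : y i j = ∏ e : Fin n × Fin n, if (i, j) = e then y e.1 e.2 else 1 := by
    rw [Finset.prod_ite_eq, if_pos (Finset.mem_univ _)]
  rw [h1, torus, torus, ← Finset.prod_mul_distrib]
  refine Finset.prod_congr rfl fun e _ => ?_
  have h2 := treeExp_sub h e
  by_cases he : e ∈ tree c
  · rw [sub_eq_iff_eq_add'.mp h2, zpow_add₀ (hy e.1 e.2 he)]
    split_ifs <;> simp
  · rw [treeExp_of_notMem he, if_neg fun h' : (i, j) = e => he (h' ▸ h)]
    simp

/-- The conjugate of `y` by the diagonal matrix with the entries `torus c y`. -/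
noncomputable def canon (c : Composition n) (y : Matrix (Fin n) (Fin n) F) :
    Matrix (Fin n) (Fin n) F :=
  Matrix.of fun i j => (torus c y i)⁻¹ * y i j * torus c y j

theorem canon_apply (i j : Fin n) : canon c y i j = (torus c y i)⁻¹ * y i j * torus c y j := rfl

theorem map_canon {F' : Type*} [Field F'] (σ : F →+* F') (i j : Fin n) :
    σ (canon c y i j) = canon c (y.map σ) i j := by
  rw [canon_apply, canon_apply, map_mul, map_mul, map_inv₀, map_torus, map_torus, Matrix.map_apply]

theorem canon_tree (hy : ∀ i j, (i, j) ∈ tree c → y i j ≠ 0) {i j : Fin n} (h : (i, j) ∈ tree c) :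
    canon c y i j = 1 := by
  rw [canon_apply, mul_assoc, mul_comm (y i j), ← torus_eq hy h,
    inv_mul_cancel₀ (torus_ne_zero hy i)]

theorem canon_supported (hy : ExtSupported c y) : ExtSupported c (canon c y) := fun i j h => by
  rw [canon_apply, hy i j h, mul_zero, zero_mul]

end Torus

/-! ### The dominant map `(u, y) ↦ u y u⁻¹`. -/

section Parametrization

variable {K : Type*} [Field K] {n : ℕ} {c : Composition n}

theorem ExtSupported.isNil {R : Type*} [CommRing R] {y : Matrix (Fin n) (Fin n) R}
    (hy : ExtSupported c y) : IsNil c y := fun i j h => hy i j fun h' => h (extBase_subset c h')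

theorem map_evalNil {A B : Type*} [CommRing A] [Algebra K A] [CommRing B] [Algebra K B]
    (φ : A →ₐ[K] B) (x : Matrix (Fin n) (Fin n) A) (p : NilPoly K c) :
    φ (evalNil x p) = evalNil (x.map φ) p := by
  rw [← AlgHom.comp_apply]
  congr 1
  ext1 γ
  simp [evalNil]

theorem evalNil_genericField (p : NilPoly K c) :
    evalNil (genericField K c) p = algebraMap (NilPoly K c) (NilField K c) p := by
  have h : evalNil (genericField K c) =
      IsScalarTower.toAlgHom K (NilPoly K c) (NilField K c) := by
    ext1 γ
    rw [evalNil, MvPolynomial.aeval_X, genericField, Matrix.map_apply, genericMatrix_of_mem γ.2]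
    rfl
  rw [h]
  rfl

/-- The substitution of elements of `B` is the conjugation of the argument. -/
theorem evalNil_substPoly (h : borel K n) {z : Matrix (Fin n) (Fin n) K} (hz : IsNil c z)
    (q : NilPoly K c) : evalNil z (substPoly c h q) =
      evalNil (((h⁻¹ : GL (Fin n) K) : Matrix (Fin n) (Fin n) K) * z *
        ((h : GL (Fin n) K) : Matrix (Fin n) (Fin n) K)) q := by
  rw [← AlgHom.comp_apply]
  congr 1
  ext1 γ
  have hX : ∀ i j, evalNil z (genericMatrix K c i j) = z i j :=
    evalNil_genericMatrix fun i j h => hz i j h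
  have hC : ∀ a : K, evalNil (c := c) z (MvPolynomial.C a) = a := (evalNil z).commutes
  simp only [AlgHom.comp_apply, substPoly, evalNil, MvPolynomial.aeval_X]
  change evalNil z _ = _
  simp only [conjGeneric, Matrix.mul_apply, map_sum, map_mul, Matrix.map_apply, hX, hC]

/-- The values of a polynomial at the matrices of `𝒳` are determined by its restriction. -/
theorem evalNil_eq_restrictPoly {A : Type*} [CommRing A] [Algebra K A]
    {z : Matrix (Fin n) (Fin n) A} (hz : ExtSupported c z)
    (hz1 : ∀ i j, (i, j) ∈ tree c → z i j = 1) (q : NilPoly K c) :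
    evalNil z q =
      MvPolynomial.aeval (fun ψ : psi c => z ψ.1.1 ψ.1.2) (restrictPoly K c q) := by
  rw [← AlgHom.comp_apply]
  congr 1
  ext1 γ
  rw [AlgHom.comp_apply, evalNil, restrictPoly, MvPolynomial.aeval_X, MvPolynomial.aeval_X]
  split_ifs with h1 h2
  · rw [MvPolynomial.aeval_X]
  · rw [map_one, hz1 _ _ ⟨h2, h1⟩]
  · rw [map_zero, hz _ _ h2]

/-- The coordinate ring of a space of pairs of a unitriangular matrix and a matrix supported on the
extended base. -/
abbrev ParamPoly (K : Type*) [Field K] (n : ℕ) : Type _ :=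
  MvPolynomial ((Fin n × Fin n) ⊕ (Fin n × Fin n)) K

open MvPolynomial in
/-- The generic unitriangular matrix. -/
noncomputable def paramUni (K : Type*) [Field K] (n : ℕ) :
    Matrix (Fin n) (Fin n) (ParamPoly K n) :=
  Matrix.of fun i j => if i < j then X (Sum.inl (i, j)) else if i = j then 1 else 0

open MvPolynomial Classical in
/-- The generic matrix supported on the extended base. -/
noncomputable def paramExt (K : Type*) [Field K] (c : Composition n) :
    Matrix (Fin n) (Fin n) (ParamPoly K n) :=
  Matrix.of fun i j => if (i, j) ∈ extBase c then X (Sum.inr (i, j)) else 0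

theorem paramUni_isUnitri : IsUnitri (paramUni K n) := by
  refine ⟨fun i j h => ?_, fun i => ?_⟩
  · rw [paramUni, Matrix.of_apply, if_neg h.asymm, if_neg h.ne']
  · rw [paramUni, Matrix.of_apply, if_neg (lt_irrefl i), if_pos rfl]

theorem paramExt_of_mem {i j : Fin n} (h : (i, j) ∈ extBase c) :
    paramExt K c i j = MvPolynomial.X (Sum.inr (i, j)) := if_pos h

theorem paramExt_supported : ExtSupported c (paramExt K c) := fun _ _ h => if_neg h

/-- The inverse of the generic unitriangular matrix. -/
noncomputable def paramInv (K : Type*) [Field K] (n : ℕ) : Matrix (Fin n) (Fin n) (ParamPoly K n) :=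
  (paramUni_isUnitri (K := K) (n := n)).exists_inv.choose

theorem paramInv_isUnitri : IsUnitri (paramInv K n) :=
  (paramUni_isUnitri (K := K) (n := n)).exists_inv.choose_spec.1

theorem paramUni_mul_paramInv : paramUni K n * paramInv K n = 1 :=
  (paramUni_isUnitri (K := K) (n := n)).exists_inv.choose_spec.2.1

theorem paramInv_mul_paramUni : paramInv K n * paramUni K n = 1 :=
  (paramUni_isUnitri (K := K) (n := n)).exists_inv.choose_spec.2.2

theorem paramMatrix_isNil : IsNil c (paramUni K n * paramExt K c * paramInv K n) :=
  ((isPar_of_upper paramUni_isUnitri.1).mul_isNil paramExt_supported.isNil).mul_isPar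
    (isPar_of_upper paramInv_isUnitri.1)

variable (K c) in
/-- The comorphism of the map `(u, y) ↦ u y u⁻¹`. -/
noncomputable def paramMap : NilPoly K c →ₐ[K] ParamPoly K n :=
  evalNil (paramUni K n * paramExt K c * paramInv K n)

section Specialize

variable {A : Type*} [CommRing A] [Algebra K A]

theorem map_paramMap (φ : ParamPoly K n →ₐ[K] A) (p : NilPoly K c) : φ (paramMap K c p) =
    evalNil ((paramUni K n).map φ * (paramExt K c).map φ * (paramInv K n).map φ) p := by
  rw [paramMap, map_evalNil, Matrix.map_mul, Matrix.map_mul]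

/-- The specialization of the parameters to the entries of `u` and `y`. -/
noncomputable def paramSpec (u y : Matrix (Fin n) (Fin n) A) : ParamPoly K n →ₐ[K] A :=
  MvPolynomial.aeval (Sum.elim (fun e => u e.1 e.2) fun e => y e.1 e.2)

theorem paramUni_map_paramSpec {u y : Matrix (Fin n) (Fin n) A} (hu : IsUnitri u) :
    (paramUni K n).map (paramSpec u y) = u := by
  ext i j
  rw [Matrix.map_apply, paramUni, Matrix.of_apply]
  split_ifs with h1 h2
  · rw [paramSpec, MvPolynomial.aeval_X, Sum.elim_inl]
  · rw [map_one, h2, hu.2]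
  · rw [map_zero, hu.1 i j (lt_of_le_of_ne (not_lt.mp h1) (Ne.symm h2))]

theorem paramExt_map_paramSpec {u y : Matrix (Fin n) (Fin n) A} (hy : ExtSupported c y) :
    (paramExt K c).map (paramSpec u y) = y := by
  ext i j
  rw [Matrix.map_apply]
  by_cases h : (i, j) ∈ extBase c
  · rw [paramExt_of_mem h, paramSpec, MvPolynomial.aeval_X, Sum.elim_inr]
  · rw [paramExt_supported i j h, map_zero, hy i j h]

theorem paramSpec_paramMap {u u' y : Matrix (Fin n) (Fin n) A} (hu : IsUnitri u)
    (hu' : u' * u = 1) (hy : ExtSupported c y) (p : NilPoly K c) :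
    paramSpec u y (paramMap K c p) = evalNil (u * y * u') p := by
  have h1 := congrArg (fun M => M.map (paramSpec u y)) (paramUni_mul_paramInv (K := K) (n := n))
  simp only [Matrix.map_mul, paramUni_map_paramSpec hu,
    Matrix.map_one _ (map_zero (paramSpec u y)) (map_one (paramSpec u y))] at h1
  have h2 : (paramInv K n).map (paramSpec u y) = u' := (left_inv_eq_right_inv hu' h1).symm
  rw [map_paramMap, paramUni_map_paramSpec hu, paramExt_map_paramSpec hy, h2]

end Specialize

variable (K c) in
-- Specializing the parameters to the normal form of the generic matrix and its conjugating matrix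
-- recovers the inclusion of `K[𝔪]` in `K(𝔪)`.
theorem paramMap_injective : Function.Injective (paramMap K c) := by
  obtain ⟨y, ⟨g, g', hg, -, h1, h2, hy⟩, hext, -⟩ := exists_genericField_uniConj (K := K) (c := c)
  have hG : g * y * g' = genericField K c := by
    calc g * y * g' = (g * g') * genericField K c * (g * g') := by rw [hy]; noncomm_ring
      _ = _ := by rw [h1, Matrix.one_mul, Matrix.mul_one]
  intro p q hpq
  have := congrArg (paramSpec g y) hpq
  rw [paramSpec_paramMap hg h2 hext, paramSpec_paramMap hg h2 hext, hG, evalNil_genericField,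
    evalNil_genericField] at this
  exact IsFractionRing.injective _ _ this

/-- The extension of `paramMap` to rational functions. -/
noncomputable def paramFieldMap (K : Type*) [Field K] (c : Composition n) :
    NilField K c →+* FractionRing (ParamPoly K n) :=
  IsFractionRing.lift (g := (algebraMap (ParamPoly K n) (FractionRing (ParamPoly K n))).comp
    (paramMap K c : NilPoly K c →+* ParamPoly K n))
    ((IsFractionRing.injective _ _).comp (paramMap_injective K c))

theorem paramFieldMap_algebraMap (p : NilPoly K c) :
    paramFieldMap K c (algebraMap _ _ p) = algebraMap _ _ (paramMap K c p) :=
  IsFractionRing.lift_algebraMap _ _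

theorem genericField_map_paramFieldMap : (genericField K c).map (paramFieldMap K c) =
    (paramUni K n * paramExt K c * paramInv K n).map
      (algebraMap (ParamPoly K n) (FractionRing (ParamPoly K n))) := by
  ext i j
  rw [genericField, Matrix.map_apply, Matrix.map_apply, paramFieldMap_algebraMap, paramMap,
    evalNil_genericMatrix fun i j h => paramMatrix_isNil i j h, Matrix.map_apply]

theorem IsUnitri.map {R R' : Type*} [CommRing R] [CommRing R'] {g : Matrix (Fin n) (Fin n) R}
    (hg : IsUnitri g) (φ : R →+* R') : IsUnitri (g.map φ) :=
  ⟨fun i j h => by rw [Matrix.map_apply, hg.1 i j h, map_zero],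
    fun i => by rw [Matrix.map_apply, hg.2, map_one]⟩

theorem ExtSupported.map {R R' : Type*} [CommRing R] [CommRing R'] {y : Matrix (Fin n) (Fin n) R}
    (hy : ExtSupported c y) (φ : R →+* R') : ExtSupported c (y.map φ) :=
  fun i j h => by rw [Matrix.map_apply, hy i j h, map_zero]

variable {y : Matrix (Fin n) (Fin n) (NilField K c)}

theorem BaseNonzero.map {F F' : Type*} [Field F] [Field F'] {y : Matrix (Fin n) (Fin n) F}
    (hy : BaseNonzero c y) (φ : F →+* F') : BaseNonzero c (y.map φ) :=
  fun i j h => by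
    rw [Matrix.map_apply]
    exact (map_ne_zero φ).mpr (hy i j h)

/-- The normal form of the generic matrix in the coordinates of the parametrization. -/
theorem map_paramFieldMap_eq (h : UniConj (genericField K c) y) (hy : ExtSupported c y)
    (hy0 : BaseNonzero c y) : y.map (paramFieldMap K c) =
      (paramExt K c).map (algebraMap (ParamPoly K n) (FractionRing (ParamPoly K n))) := by
  obtain ⟨g, g', hg, hg', h1, h2, hyg⟩ := h
  let j := algebraMap (ParamPoly K n) (FractionRing (ParamPoly K n))
  have hk := (hg'.map (paramFieldMap K c)).mul ((paramUni_isUnitri (K := K) (n := n)).map j)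
  refine eq_of_unitriangular_conj (hy.map _) (hy0.map _) (paramExt_supported.map j) hk.1 hk.2 ?_
  have e1 : y.map (paramFieldMap K c) = g'.map (paramFieldMap K c) *
      ((paramUni K n).map j * (paramExt K c).map j * (paramInv K n).map j) *
        g.map (paramFieldMap K c) := by
    rw [← Matrix.map_mul, ← Matrix.map_mul, ← genericField_map_paramFieldMap, ← Matrix.map_mul,
      ← Matrix.map_mul, ← hyg]
  have e2 : g.map (paramFieldMap K c) * g'.map (paramFieldMap K c) = 1 := by
    rw [← Matrix.map_mul, h1, Matrix.map_one _ (map_zero _) (map_one _)]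
  have e3 : (paramInv K n).map j * (paramUni K n).map j = 1 := by
    rw [← Matrix.map_mul, paramInv_mul_paramUni, Matrix.map_one _ (map_zero _) (map_one _)]
  rw [e1]
  calc _ = g'.map (paramFieldMap K c) * (paramUni K n).map j * (paramExt K c).map j *
        (paramInv K n).map j * (g.map (paramFieldMap K c) * g'.map (paramFieldMap K c)) *
          (paramUni K n).map j := by noncomm_ring
    _ = g'.map (paramFieldMap K c) * (paramUni K n).map j * (paramExt K c).map j *
        ((paramInv K n).map j * (paramUni K n).map j) := by rw [e2]; noncomm_ring
    _ = _ := by rw [e3, Matrix.mul_one]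

/-- In the parameters these entries are variables. The elimination gives this only on the base,
while the torus also divides by entries on `Φ`. -/
theorem normalForm_ne_zero (h : UniConj (genericField K c) y) (hy : ExtSupported c y)
    (hy0 : BaseNonzero c y) {i j : Fin n} (hij : (i, j) ∈ extBase c) : y i j ≠ 0 := by
  have h1 := congrFun (congrFun (map_paramFieldMap_eq h hy hy0) i) j
  rw [Matrix.map_apply, Matrix.map_apply, paramExt_of_mem hij] at h1
  intro h0
  rw [h0, map_zero] at h1
  exact MvPolynomial.X_ne_zero _ (IsFractionRing.injective (ParamPoly K n) _
    (h1.symm.trans (map_zero _).symm))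

/-- A polynomial that divides all its translates by `B` and vanishes on `𝒳` is zero. -/
theorem eq_zero_of_restrictPoly_eq_zero [Infinite K] {q : NilPoly K c}
    (hq : ∀ h : borel K n, q ∣ substPoly c h q) (h0 : restrictPoly K c q = 0) : q = 0 := by
  apply paramMap_injective K c
  rw [map_zero]
  -- Multiplying by all the variables of `y` leaves only points with nonzero entries to check. There
  -- `u y u⁻¹` is `B`-conjugate to a point of `𝒳`, and vanishing at all points suffices over an
  -- infinite field.
  have hprod : (∏ e : Fin n × Fin n, (MvPolynomial.X (Sum.inr e) : ParamPoly K n)) ≠ 0 :=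
    Finset.prod_ne_zero_iff.mpr fun e _ => MvPolynomial.X_ne_zero _
  refine (mul_eq_zero.mp (MvPolynomial.funext (p := paramMap K c q *
    ∏ e : Fin n × Fin n, MvPolynomial.X (Sum.inr e)) (q := 0) fun p => ?_)).resolve_right hprod
  rw [map_mul, map_prod, map_zero]
  simp only [MvPolynomial.eval_X]
  by_cases hp : ∀ e, p (Sum.inr e) ≠ 0
  swap
  · push Not at hp
    obtain ⟨e, he⟩ := hp
    rw [Finset.prod_eq_zero (Finset.mem_univ e) he, mul_zero]
  refine mul_eq_zero_of_left ?_ _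
  let φ : ParamPoly K n →ₐ[K] K := MvPolynomial.aeval p
  change φ (paramMap K c q) = 0
  rw [map_paramMap]
  have hu := (paramUni_isUnitri (K := K) (n := n)).map (φ : ParamPoly K n →+* K)
  have hu' := (paramInv_isUnitri (K := K) (n := n)).map (φ : ParamPoly K n →+* K)
  have hy := (paramExt_supported (K := K) (c := c)).map (φ : ParamPoly K n →+* K)
  have h1 : (paramUni K n).map φ * (paramInv K n).map φ = 1 := by
    rw [← Matrix.map_mul, paramUni_mul_paramInv, Matrix.map_one _ (map_zero _) (map_one _)]
  have h2 : (paramInv K n).map φ * (paramUni K n).map φ = 1 := by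
    rw [← Matrix.map_mul, paramInv_mul_paramUni, Matrix.map_one _ (map_zero _) (map_one _)]
  have hy0 : ∀ i j, (i, j) ∈ tree c → (paramExt K c).map φ i j ≠ 0 := fun i j h => by
    rw [Matrix.map_apply, paramExt_of_mem h.1]
    simpa [φ] using hp (i, j)
  change IsUnitri ((paramUni K n).map φ) at hu
  change IsUnitri ((paramInv K n).map φ) at hu'
  change ExtSupported c ((paramExt K c).map φ) at hy
  generalize (paramUni K n).map φ = u at *
  generalize (paramInv K n).map φ = u' at *
  generalize (paramExt K c).map φ = y at *
  have ht := torus_ne_zero hy0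
  have hd1 : Matrix.diagonal (torus c y) * Matrix.diagonal (fun i => (torus c y i)⁻¹) = 1 := by
    simp [Matrix.diagonal_mul_diagonal, ht]
  have hd2 : Matrix.diagonal (fun i => (torus c y i)⁻¹) * Matrix.diagonal (torus c y) = 1 := by
    simp [Matrix.diagonal_mul_diagonal, ht]
  let h : GL (Fin n) K := ⟨Matrix.diagonal (fun i => (torus c y i)⁻¹) * u',
    u * Matrix.diagonal (torus c y), by
      rw [Matrix.mul_assoc, ← Matrix.mul_assoc u', h2, Matrix.one_mul, hd2], by
      rw [Matrix.mul_assoc, ← Matrix.mul_assoc (Matrix.diagonal (torus c y)), hd1, Matrix.one_mul,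
        h1]⟩
  have hh : h ∈ borel K n := by
    intro i j hij
    exact upper_mul (fun i j hij => Matrix.diagonal_apply_ne _ hij.ne') hu'.1 i j hij
  have hz : canon c y =
      Matrix.diagonal (fun i => (torus c y i)⁻¹) * y * Matrix.diagonal (torus c y) := by
    ext i j
    rw [Matrix.mul_diagonal, Matrix.diagonal_mul, canon_apply]
  have hconj : u * y * u' = ((h⁻¹ : GL (Fin n) K) : Matrix (Fin n) (Fin n) K) * canon c y *
      (h : Matrix (Fin n) (Fin n) K) := by
    change _ = u * Matrix.diagonal (torus c y) * canon c y *
      (Matrix.diagonal (fun i => (torus c y i)⁻¹) * u')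
    rw [hz]
    symm
    calc _ = u * (Matrix.diagonal (torus c y) * Matrix.diagonal (fun i => (torus c y i)⁻¹)) * y *
          (Matrix.diagonal (torus c y) * Matrix.diagonal (fun i => (torus c y i)⁻¹)) * u' := by
            noncomm_ring
      _ = _ := by rw [hd1, Matrix.mul_one, Matrix.mul_one]
  have hcs := canon_supported hy
  have h3 := evalNil_substPoly ⟨h, hh⟩ hcs.isNil q
  simp only at h3
  rw [hconj, ← h3]
  obtain ⟨r, hr⟩ := hq ⟨h, hh⟩
  rw [hr, map_mul, evalNil_eq_restrictPoly hcs (fun i j => canon_tree hy0), h0, map_zero, zero_mul]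

end Parametrization

/-! ### Invariance of the canonical entries. -/

section Invariance

variable {K : Type*} [Field K] {n : ℕ} {c : Composition n}

theorem borelAct_algebraMap (h : borel K n) (p : NilPoly K c) :
    borelAct c h (algebraMap _ _ p) = algebraMap _ _ (substPoly c h p) := by
  rw [borelAct, MonoidHom.comp_apply, IsFractionRing.fieldEquivOfAlgEquivHom_apply,
    IsFractionRing.fieldEquivOfAlgEquiv_algebraMap]
  rfl

theorem mem_borelInvariants {f : NilField K c} :
    f ∈ borelInvariants K c ↔ ∀ h : borel K n, borelAct c h f = f := by
  rw [borelInvariants, IntermediateField.mem_fixedField_iff]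
  constructor
  · exact fun H h => H _ ⟨h, rfl⟩
  · rintro H _ ⟨h, rfl⟩
    exact H h

theorem genericField_map_borelAct (h : borel K n) : (genericField K c).map (borelAct c h) =
    ((h⁻¹ : GL (Fin n) K) : Matrix (Fin n) (Fin n) K).map (algebraMap K (NilField K c)) *
      genericField K c *
        ((h : GL (Fin n) K) : Matrix (Fin n) (Fin n) K).map (algebraMap K (NilField K c)) := by
  have hC : ∀ A : Matrix (Fin n) (Fin n) K, A.map (algebraMap K (NilField K c)) =
      (A.map (MvPolynomial.C : K →+* NilPoly K c)).map
        (algebraMap (NilPoly K c) (NilField K c)) := fun A => by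
    ext i j
    exact IsScalarTower.algebraMap_apply K (NilPoly K c) (NilField K c) (A i j)
  rw [hC, hC, genericField, ← Matrix.map_mul, ← Matrix.map_mul]
  change _ = (conjGeneric c h).map _
  rw [← genericMatrix_map_substPoly]
  ext i j
  simp only [Matrix.map_apply, borelAct_algebraMap]

variable {y : Matrix (Fin n) (Fin n) (NilField K c)}

/-- The entries of the canonical form of the generic matrix are invariants. -/
theorem canon_mem_borelInvariants (h : UniConj (genericField K c) y) (hy : ExtSupported c y)
    (hy0 : BaseNonzero c y) {j l : Fin n} (hjl : (j, l) ∈ psi c) :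
    canon c y j l ∈ borelInvariants K c := by
  have hne : ∀ i j, (i, j) ∈ extBase c → y i j ≠ 0 := fun i j => normalForm_ne_zero h hy hy0
  have ht := torus_ne_zero fun i j (hij : (i, j) ∈ tree c) => hne i j hij.1
  obtain ⟨g, g', hg, hg', h1, h2, hyg⟩ := h
  rw [mem_borelInvariants]
  intro b
  let σ : NilField K c →+* NilField K c := (borelAct c b : NilField K c →+* NilField K c)
  change σ _ = _
  have hσt : ∀ i, σ (torus c y i) ≠ 0 := fun i => (map_ne_zero σ).mpr (ht i)
  let β : Matrix (Fin n) (Fin n) (NilField K c) :=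
    ((b : GL (Fin n) K) : Matrix (Fin n) (Fin n) K).map (algebraMap K (NilField K c))
  let β' : Matrix (Fin n) (Fin n) (NilField K c) :=
    ((b⁻¹ : GL (Fin n) K) : Matrix (Fin n) (Fin n) K).map (algebraMap K (NilField K c))
  have hβ : ∀ i j, j < i → β i j = 0 := fun i j hij => by
    have : ((b : GL (Fin n) K) : Matrix (Fin n) (Fin n) K).BlockTriangular id := b.2
    change algebraMap K (NilField K c) _ = 0
    rw [this hij, map_zero]
  have hβ' : ∀ i j, j < i → β' i j = 0 := fun i j hij => by
    have : ((b⁻¹ : GL (Fin n) K) : Matrix (Fin n) (Fin n) K).BlockTriangular id := (b⁻¹).2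
    change algebraMap K (NilField K c) _ = 0
    rw [this hij, map_zero]
  have hββ : β * β' = 1 := by
    rw [← Matrix.map_mul, ← Units.val_mul, mul_inv_cancel, Units.val_one,
      Matrix.map_one _ (map_zero _) (map_one _)]
  have hσg : g.map σ * g'.map σ = 1 := by
    rw [← Matrix.map_mul, h1, Matrix.map_one _ (map_zero _) (map_one _)]
  have hG : g * y * g' = genericField K c := by
    calc g * y * g' = (g * g') * genericField K c * (g * g') := by rw [hyg]; noncomm_ring
      _ = _ := by rw [h1, Matrix.one_mul, Matrix.mul_one]
  have hσG : (genericField K c).map σ = β' * genericField K c * β := genericField_map_borelAct b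
  have hσy : y.map σ = g'.map σ * (β' * (g * y * g') * β) * g.map σ := by
    rw [hG, ← hσG, ← Matrix.map_mul, ← Matrix.map_mul, ← hyg]
  let k := g'.map σ * β' * g
  let k' := g' * β * g.map σ
  have hk : ∀ i j, j < i → k i j = 0 := upper_mul (upper_mul (hg'.map σ).1 hβ') hg.1
  have hk' : ∀ i j, j < i → k' i j = 0 := upper_mul (upper_mul hg'.1 hβ) (hg.map σ).1
  have hkk : k' * k = 1 := by
    calc k' * k = g' * β * (g.map σ * g'.map σ) * β' * g := by simp only [k, k']; noncomm_ring
      _ = g' * (β * β') * g := by rw [hσg]; noncomm_ring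
      _ = 1 := by rw [hββ, Matrix.mul_one, h2]
  have hk0 : ∀ i, k i i ≠ 0 := fun i h0 => by
    have := upper_mul_diag hk' hk i
    rw [hkk, Matrix.one_apply_eq, h0, mul_zero] at this
    exact one_ne_zero this
  have hconj : y.map σ * k = k * y := by
    calc y.map σ * k = k * y * (k' * k) := by rw [hσy]; simp only [k, k']; noncomm_ring
      _ = _ := by rw [hkk, Matrix.mul_one]
  have hdiag : ∀ {i j : Fin n}, (i, j) ∈ extBase c → σ (y i j) * k j j = k i i * y i j :=
    fun hij => conj_diag_of_conj (hy.map σ) (hy0.map σ) hy hk hconj hij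
  -- The diagonal matrix relating the canonical form to its transform under `b`. As the canonical
  -- entries on the forest are `1`, `γ` is constant on components, so it cancels at the roots of
  -- `Ψ`.
  let γ : Fin n → NilField K c := fun i => (σ (torus c y i))⁻¹ * k i i * torus c y i
  have hγ0 : ∀ i, γ i ≠ 0 := fun i =>
    mul_ne_zero (mul_ne_zero (inv_ne_zero (hσt i)) (hk0 i)) (ht i)
  have hσc : ∀ {i j : Fin n}, (i, j) ∈ extBase c →
      σ (canon c y i j) * γ j = γ i * canon c y i j := by
    intro i j hij
    have h3 := hdiag hij
    have h4 := hσt i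
    have h5 := hσt j
    have h6 := ht i
    simp only [canon_apply, map_mul, map_inv₀, γ]
    field_simp
    linear_combination torus c y j * h3
  have hγ : ∀ i j, (i, j) ∈ tree c → γ i = γ j := by
    intro i j hij
    have h3 := hσc hij.1
    rw [canon_tree (fun i j (hij : (i, j) ∈ tree c) => hne i j hij.1) hij, map_one, one_mul,
      mul_one] at h3
    exact h3.symm
  have h3 := hσc (psi_subset_extBase hjl)
  rw [eq_on_psi hγ hjl, mul_comm] at h3
  exact mul_left_cancel₀ (hγ0 l) h3

end Invariance

/-! ### Restricting invariants to the canonical matrices. -/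

section Restriction

variable {K : Type*} [Field K] {n : ℕ} {c : Composition n}

/-- In a reduced fraction `p / q`, invariance gives that `q` divides `p` times each translate of
`q`; by coprimality it divides the translate. -/
theorem exists_eq_div_of_mem_borelInvariants [Infinite K] {f : NilField K c}
    (hf : f ∈ borelInvariants K c) : ∃ p q : NilPoly K c, restrictPoly K c q ≠ 0 ∧
      f * algebraMap _ _ q = algebraMap _ _ p := by
  obtain ⟨p, q, hpq, hfpq⟩ := IsFractionRing.exists_reduced_fraction (NilPoly K c) f
  have hq0 : (q : NilPoly K c) ≠ 0 := nonZeroDivisors.ne_zero q.2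
  have hf' : f * algebraMap _ _ (q : NilPoly K c) = algebraMap _ _ p := by
    rw [← hfpq]
    exact IsLocalization.mk'_spec _ _ _
  refine ⟨p, q, fun h0 => hq0 (eq_zero_of_restrictPoly_eq_zero (fun h => ?_) h0), hf'⟩
  have h1 : p * substPoly c h q = substPoly c h p * q := by
    apply IsFractionRing.injective (NilPoly K c) (NilField K c)
    have h2 := congrArg (borelAct c h) hf'
    rw [map_mul, mem_borelInvariants.mp hf h, borelAct_algebraMap, borelAct_algebraMap] at h2
    rw [map_mul, map_mul, ← hf', ← h2]
    ring
  exact hpq.symm.dvd_of_dvd_mul_left ⟨substPoly c h p, h1.trans (mul_comm _ _)⟩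

theorem mem_restrictable {f : NilField K c} {p q : NilPoly K c} (hq : restrictPoly K c q ≠ 0)
    (h : f * algebraMap _ _ q = algebraMap _ _ p) : f ∈ restrictable K c := by
  have hq0 : algebraMap (NilPoly K c) (NilField K c) q ≠ 0 := fun h0 => hq (by
    rw [IsFractionRing.injective (NilPoly K c) (NilField K c) (h0.trans (map_zero _).symm),
      map_zero])
  exact ⟨p, q, mem_nonZeroDivisors_of_ne_zero hq, (eq_mul_inv_iff_mul_eq₀ hq0).mpr h⟩

theorem restrict_mul (f : restrictable K c) {p q : NilPoly K c}
    (h : (f : NilField K c) * algebraMap _ _ q = algebraMap _ _ p) :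
    restrict K c f * algebraMap _ _ (restrictPoly K c q) = algebraMap _ _ (restrictPoly K c p) := by
  have hr : ∀ p : NilPoly K c, restrict K c (algebraMap _ _ p) =
      algebraMap _ _ (restrictPoly K c p) := fun p =>
    (IsLocalization.liftAlgHom_apply _ _).trans (IsLocalization.lift_eq _ p)
  rw [← hr, ← hr, ← map_mul]
  congr 1
  exact Subtype.ext h

variable {y : Matrix (Fin n) (Fin n) (NilField K c)}

theorem restrictPoly_of_canon (h : UniConj (genericField K c) y) (hy : ExtSupported c y)
    (hy0 : BaseNonzero c y) (ψ : psi c) {p q : NilPoly K c}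
    (hpq : canon c y ψ.1.1 ψ.1.2 * algebraMap _ _ q = algebraMap _ _ p) :
    MvPolynomial.X ψ * restrictPoly K c q = restrictPoly K c p := by
  classical
  obtain ⟨⟨j, l⟩, hjl⟩ := ψ
  let E := FractionRing (ParamPoly K n)
  let a := algebraMap (ParamPoly K n) E
  -- For `s = 1` and `s = -1`, the numerator and denominator of the torus entry. Clearing them gives
  -- a polynomial identity that can be specialized to `u = 1` and `y` in `𝒳`, where both monomials
  -- become `1`.
  let m (i : Fin n) (s : ℤ) : ParamPoly K n :=
    ∏ e : Fin n × Fin n, paramExt K c e.1 e.2 ^ (s * treeExp c e i).toNat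
  have hne : ∀ i j, (i, j) ∈ tree c → (paramExt K c).map a i j ≠ 0 := fun i j hij => by
    rw [Matrix.map_apply, paramExt_of_mem hij.1]
    exact fun h0 => MvPolynomial.X_ne_zero _ (IsFractionRing.injective (ParamPoly K n) E
      (h0.trans (map_zero _).symm))
  have ht := torus_ne_zero hne
  have hm : ∀ i, torus c ((paramExt K c).map a) i * a (m i (-1)) = a (m i 1) := by
    intro i
    simp only [m, torus, map_prod, map_pow]
    rw [← Finset.prod_mul_distrib]
    refine Finset.prod_congr rfl fun e _ => ?_
    by_cases he : e ∈ tree c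
    · have h0 := hne e.1 e.2 he
      change _ * (paramExt K c).map a e.1 e.2 ^ _ = (paramExt K c).map a e.1 e.2 ^ _
      rw [← zpow_natCast, ← zpow_natCast, ← zpow_add₀ h0]
      congr 1
      omega
    · simp [treeExp_of_notMem he]
  have key : paramMap K c q * MvPolynomial.X (Sum.inr (j, l)) * m j (-1) * m l 1 =
      paramMap K c p * m j 1 * m l (-1) := by
    apply IsFractionRing.injective (ParamPoly K n) E
    have h1 := congrArg (paramFieldMap K c) hpq
    rw [map_mul, map_canon, map_paramFieldMap_eq h hy hy0, paramFieldMap_algebraMap,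
      paramFieldMap_algebraMap, canon_apply, Matrix.map_apply,
      paramExt_of_mem (psi_subset_extBase hjl)] at h1
    simp only [map_mul]
    change a _ * a _ * a _ * a _ = a _ * a _ * a _
    rw [← h1, ← hm j, ← hm l]
    have h2 := inv_mul_cancel₀ (ht j)
    change _ = (torus c ((paramExt K c).map a) j)⁻¹ * a _ * torus c ((paramExt K c).map a) l *
      a _ * _ * _
    linear_combination (-(a (MvPolynomial.X (Sum.inr (j, l))) * torus c ((paramExt K c).map a) l *
      a (paramMap K c q) * a (m j (-1)) * a (m l (-1)))) * h2
  let z : Matrix (Fin n) (Fin n) (CanonPoly K c) := Matrix.of fun i j =>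
    if h : (i, j) ∈ psi c then MvPolynomial.X ⟨(i, j), h⟩ else if (i, j) ∈ extBase c then 1 else 0
  have hz : ExtSupported c z := fun i j hij => by
    change dite _ _ _ = _
    rw [dif_neg fun h => hij (psi_subset_extBase h), if_neg hij]
  have hz1 : ∀ i j, (i, j) ∈ tree c → z i j = 1 := fun i j hij => by
    change dite _ _ _ = _
    rw [dif_neg hij.2, if_pos hij.1]
  have hres : ∀ r : NilPoly K c, paramSpec 1 z (paramMap K c r) = restrictPoly K c r := by
    intro r
    rw [paramSpec_paramMap .one (Matrix.one_mul 1) hz, Matrix.one_mul, Matrix.mul_one, evalNil,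
      restrictPoly]
    rfl
  have hmz : ∀ i s, paramSpec 1 z (m i s) = 1 := by
    intro i s
    simp only [m, map_prod, map_pow]
    refine Finset.prod_eq_one fun e _ => ?_
    by_cases he : e ∈ tree c
    · have : paramSpec 1 z (paramExt K c e.1 e.2) = z e.1 e.2 :=
        congrFun (congrFun (paramExt_map_paramSpec (u := 1) hz) e.1) e.2
      rw [this, hz1 _ _ he, one_pow]
    · simp [treeExp_of_notMem he]
  have h2 := congrArg (paramSpec 1 z) key
  simp only [map_mul, hmz, hres, mul_one] at h2
  rw [← h2, mul_comm]
  congr 1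
  rw [paramSpec, MvPolynomial.aeval_X, Sum.elim_inr]
  change _ = dite _ _ _
  rw [dif_pos hjl]

end Restriction

/-! ### The restriction isomorphism. -/

section Main

variable (K : Type*) [Field K] [Infinite K] {n : ℕ} (c : Composition n)

/-- The invariants can be restricted to `𝒳`, and the restriction is an isomorphism onto the field of
rational functions on `𝒳`. -/
theorem restrict_bijective : ∃ h : ∀ f ∈ borelInvariants K c, f ∈ restrictable K c,
    Function.Bijective fun f : borelInvariants K c => restrict K c ⟨f.1, h f.1 f.2⟩ := by
  have hmem : ∀ f ∈ borelInvariants K c, f ∈ restrictable K c := fun f hf => by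
    obtain ⟨p, q, hq, hpq⟩ := exists_eq_div_of_mem_borelInvariants hf
    exact mem_restrictable hq hpq
  refine ⟨hmem, ?_⟩
  let ρ : borelInvariants K c →+* CanonField K c := (restrict K c : restrictable K c →+* _).comp
    ((borelInvariants K c).val.toRingHom.codRestrict (restrictable K c) fun f => hmem f.1 f.2)
  change Function.Bijective ρ
  refine ⟨ρ.injective, ?_⟩
  obtain ⟨y, hy1, hy2, hy3⟩ := exists_genericField_uniConj (K := K) (c := c)
  have hX : ∀ ψ : psi c, algebraMap (CanonPoly K c) (CanonField K c) (MvPolynomial.X ψ) ∈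
      ρ.fieldRange := by
    intro ψ
    have hinv := canon_mem_borelInvariants hy1 hy2 hy3 ψ.2
    obtain ⟨p, q, hq, hpq⟩ := exists_eq_div_of_mem_borelInvariants hinv
    refine ⟨⟨_, hinv⟩, ?_⟩
    have h1 := restrict_mul ⟨_, hmem _ hinv⟩ hpq
    rw [← restrictPoly_of_canon hy1 hy2 hy3 ψ hpq, map_mul] at h1
    exact mul_right_cancel₀ (fun h0 => hq (IsFractionRing.injective _ (CanonField K c)
      (h0.trans (map_zero _).symm))) h1
  have hpoly : ∀ p : CanonPoly K c, algebraMap _ (CanonField K c) p ∈ ρ.fieldRange := by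
    intro p
    induction p using MvPolynomial.induction_on with
    | C a => exact ⟨algebraMap K _ a, (restrict K c).commutes a⟩
    | add p q hp hq =>
      rw [map_add]
      exact add_mem hp hq
    | mul_X p ψ hp =>
      rw [map_mul]
      exact mul_mem hp (hX ψ)
  intro x
  obtain ⟨p, q, -, rfl⟩ := IsFractionRing.div_surjective (A := CanonPoly K c) x
  exact div_mem (hpoly p) (hpoly q)

end Main

end BorelNilradical

theorem theorem4p3 (K : Type*) [Field K] [IsAlgClosed K] [CharZero K] {n : ℕ}
    (c : Composition n) :
    ∃ h : ∀ f ∈ BorelNilradical.borelInvariants K c, f ∈ BorelNilradical.restrictable K c,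
      Function.Bijective fun f : BorelNilradical.borelInvariants K c =>
        BorelNilradical.restrict K c ⟨f.1, h f.1 f.2⟩ :=
  BorelNilradical.restrict_bijective K c
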